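/- **Setting.** Let $N,p\ge 1$ be integers. The state space $\mathbf X$ is a measurable space with $\sigma$-algebra $\mathfrak X$; the action spaces $\mathbf A^1,\dots,\mathbf A^N$ are separable metric spaces with their Borel $\sigma$-algebras, and $\mathbf A=\mathbf A^1\times\dots\times\mathbf A^N$. For each $i$ and each $x\in\mathbf X$ a nonempty measurable set $\mathbf A^i(x)\subseteq\mathbf A^i$ of available actions is given, and $\mathbf A(x)=\mathbf A^1(x)\times\dots\times\mathbf A^N(x)$. Let $r^i:\mathbf X\times\mathbf A\to\mathbb R$ and $c^i=(c^{i,1},\dots,c^{i,p}):\mathbf X\times\mathbf A\to\mathbb R^p$ be bounded measurable functions, $Q$ a stochastic kernel on $\mathbf X$ given $\mathbf X\times\mathbf A$, $\eta$ a probability measure on $\mathbf X$ (the initial distribution), and $\rho=(\rho^1,\dots,\rho^N)\in(\mathbb R^p)^N$. These data form the game $\mathcal G(\eta,\rho)$. Let $\mathbf H_t=(\mathbf X\times\mathbf A)^t\times\mathbf X$ be the set of histories $h_t=(x_0,a_0,\dots,x_{t-1},a_{t-1},x_t)$. A *policy* of player $i$ is a sequence $(\pi^i_t)_{t\ge0}$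 of stochastic kernels on $\mathbf A^i$ given $\mathbf H_t$ with $\pi^i_t(\mathbf A^i(x_t)\mid h_t)=1$ for all $h_t$; $\mathbf\Pi^i$ is the set of policies of player $i$ and $\mathbf\Pi=\mathbf\Pi^1\times\dots\times\mathbf\Pi^N$. A *correlated strategy* is a sequence $\pi=(\pi_t)_{t\ge0}$ of stochastic kernels on $\mathbf A$ given $\mathbf H_t$ with $\pi_t(\mathbf A(x_t)\mid h_t)=1$ for all $h_t$; $\tilde{\mathbf\Pi}$ is the set of correlated strategies, and $\tilde{\mathbf M}\subseteq\tilde{\mathbf\Pi}$ is the set of those given by one stochastic kernel on $\mathbf A$ given $\mathbf X$ (that is, $\pi_t(\cdot\mid h_t)=\pi(\cdot\mid x_t)$). A profile in $\mathbf\Pi$ is regarded as the correlated strategy $\pi_t(\cdot\mid h_t)=\pi^1_t(\cdot\mid h_t)\otimes\dots\otimes\pi^N_t(\cdot\mid h_t)$. For $\pi\in\tilde{\mathbf\Pi}$ and an initial distribution $\nu$, $\mathbb P_{\nu,\pi}$ is the law on $(\mathbf X\times\mathbf A)^{\mathbb N}$ of the process $(X_t,A_t)_{t\ge0}$ with $X_0\sim\nu$,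 with $A_t\sim\pi_t(\cdot\mid X_0,A_0,\dots,X_t)$ given the history up to $X_t$, and with $X_{t+1}\sim Q(\cdot\mid X_t,A_t)$ given the history up to $A_t$. For $\Delta\in\mathfrak X$ let $T_\Delta=\min\{n\ge0:X_n\in\Delta\}\in\mathbb N\cup\{\infty\}$. For a probability measure $\nu$ on $\mathbf X$, the game $\mathcal G(\nu,\rho)$ is *absorbing to $\Delta$* if for all $x\in\Delta$, $a\in\mathbf A$ and all $i,j$ we have $Q(\Delta\mid x,a)=1$ and $r^i(x,a)=c^{i,j}(x,a)=0$, and $\mathbb E_{\nu,\pi}[T_\Delta]<\infty$ for every $\pi\in\tilde{\mathbf\Pi}$. It is *uniformly absorbing to $\Delta$* if, in addition, $\lim_{n\to\infty}\sup_{\pi\in\tilde{\mathbf M}}\sum_{t\ge n}\mathbb P_{\nu,\pi}\{T_\Delta>t\}=0$. **Assumption A.** There are a probability measure $\lambda$ on $\mathbf X$ and a set $\Delta\in\mathfrak X$, fixed from now on, such that: 1. $\mathcal G(\eta,\rho)$ is absorbing to $\Delta$; 2. (Slater condition) for every $\pi\in\mathbf\Pi$ and every $i$ there is $\sigma\in\mathbf\Pi^i$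 such that, when player $i$ replaces $\pi^i$ by $\sigma$ in $\pi$, the expected total cost $\mathbb E_\eta[\sum_{t\ge0}c^i(X_t,A_t)]$ is strictly greater than $\rho^i$ in every component; 3. $\mathfrak X$ is countably generated; 4. each $\mathbf A^i$ is compact, each $\mathbf A^i(x)$ is compact, and $\{x:\mathbf A^i(x)\cap U\neq\emptyset\}\in\mathfrak X$ for every open $U\subseteq\mathbf A^i$; 5. all $r^i$ and $c^i$ are bounded Carathéodory functions (measurable in $x$, continuous in $a$); 6. there is a measurable $q:\mathbf X\times\mathbf X\times\mathbf A\to[0,\infty)$ with $Q(B\mid x,a)=\int_B q(y,x,a)\,\lambda(dy)$ for all $B\in\mathfrak X$ and all $(x,a)$, and $\int_{\mathbf X}|q(y,x,a_n)-q(y,x,a)|\,\lambda(dy)\to0$ for every $x$ whenever $a_n\to a$ in $\mathbf A$; 7. $\mathcal G(\lambda,\rho)$ is absorbing to $\Delta$; 8. $\eta\ll\lambda$. For $\pi\in\tilde{\mathbf\Pi}$ the *occupation measure* is the finite measure $$\mu_{\eta,\pi}(E)=\mathbb E_{\eta,\pi}\Big[\sum_{t=0}^\infty \mathbf 1_{\{T_\Delta>t\}}\mathbf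 1_{\{(X_t,A_t)\in E\}}\Big]$$ on $\mathbf X\times\mathbf A$. Let $\tilde{\mathcal O}_\eta=\{\mu_{\eta,\pi}:\pi\in\tilde{\mathbf\Pi}\}$, and for $1\le i\le N$ let $\tilde{\mathcal O}^i_\eta$ be the set of the $\mathbf X\times\mathbf A^i$-marginals of the measures in $\tilde{\mathcal O}_\eta$. For $\mathbf S=\mathbf A$ or $\mathbf S=\mathbf A^i$, the *$ws$-topology* on the finite nonnegative measures on $\mathbf X\times\mathbf S$ is the coarsest topology for which $\mu\mapsto\int f\,d\mu$ is continuous for every bounded Carathéodory function $f:\mathbf X\times\mathbf S\to\mathbb R$. **Proposition 4.8.** Under Assumption A, the set $\tilde{\mathcal O}_\eta$ and the sets $\tilde{\mathcal O}^i_\eta$, $1\le i\le N$, are convex. Moreover, for every $i\in\{1,\dots,N\}$, the following statements are equivalent: (a) the game $\mathcal G(\eta,\rho)$ is uniformly absorbing to $\Delta$; (b) $\tilde{\mathcal O}_\eta$ with the $ws$-topology is a compact metrizable space; (c) $\tilde{\mathcal O}^i_\eta$ with the $ws$-topology is a compact metrizable space. -/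

import Mathlib

open MeasureTheory ProbabilityTheory Filter Topology
open scoped ENNReal NNReal

namespace MarkovGame

/-! ### Carathéodory functions and the weak-strong topology -/

/-- `f : Ω × S → E` is a Carathéodory function: measurable in the first variable and continuous in
the second one. -/
def IsCaratheodory {Ω S E : Type*} [MeasurableSpace Ω] [TopologicalSpace S]
    [TopologicalSpace E] [MeasurableSpace E] (f : Ω × S → E) : Prop :=
  (∀ s : S, Measurable fun ω => f (ω, s)) ∧ ∀ ω : Ω, Continuous fun s => f (ω, s)

/-- Bounded Carathéodory functions. -/
def IsBoundedCaratheodory {Ω S E : Type*} [MeasurableSpace Ω] [TopologicalSpace S]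
    [NormedAddCommGroup E] [MeasurableSpace E] (f : Ω × S → E) : Prop :=
  IsCaratheodory f ∧ ∃ C : ℝ, ∀ z, ‖f z‖ ≤ C

/-- The `ws`-topology on the finite nonnegative measures on `Ω × S`: the coarsest topology for which
`μ ↦ ∫ f dμ` is continuous for every bounded real-valued Carathéodory function `f` on `Ω × S`. -/
noncomputable abbrev wsTopology (Ω S : Type*) [MeasurableSpace Ω] [TopologicalSpace S]
    [MeasurableSpace S] : TopologicalSpace (FiniteMeasure (Ω × S)) :=
  ⨅ f : {f : Ω × S → ℝ // IsBoundedCaratheodory f},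
    TopologicalSpace.induced
      (fun μ : FiniteMeasure (Ω × S) => ∫ z, f.1 z ∂(μ : Measure (Ω × S))) inferInstance

/-- The subset `s`, with the trace of the topology `τ`, is a compact metrizable space. -/
def IsCompactMetrizable {E : Type*} (τ : TopologicalSpace E) (s : Set E) : Prop :=
  @CompactSpace s (τ.induced Subtype.val) ∧
    @TopologicalSpace.MetrizableSpace s (τ.induced Subtype.val)

/-! ### The game model -/

/-- The data of an `N`-player game with `p` constraints per player, on the state space `X` and with
action spaces `A i`; the initial distribution and the constraint constants are kept apart. -/
structure GameModel (X : Type*) [MeasurableSpace X] {N : ℕ} (A : Fin N → Type*)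
    [∀ i, MeasurableSpace (A i)] (p : ℕ) where
  /-- the set of actions available to a player at a state -/
  actions : ∀ i : Fin N, X → Set (A i)
  actions_nonempty : ∀ i x, (actions i x).Nonempty
  measurableSet_actions : ∀ i x, MeasurableSet (actions i x)
  /-- the reward functions -/
  reward : Fin N → X × (∀ j, A j) → ℝ
  measurable_reward : ∀ i, Measurable (reward i)
  bounded_reward : ∀ i, ∃ C : ℝ, ∀ z, ‖reward i z‖ ≤ C
  /-- the constraint functions -/
  cost : Fin N → X × (∀ j, A j) → Fin p → ℝ
  measurable_cost : ∀ i, Measurable (cost i)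
  bounded_cost : ∀ i, ∃ C : ℝ, ∀ z, ‖cost i z‖ ≤ C
  /-- the transition kernel -/
  Q : Kernel (X × (∀ j, A j)) X
  isMarkovKernel_Q : IsMarkovKernel Q

attribute [instance] GameModel.isMarkovKernel_Q

/-- Histories `h_t = (x_0, a_0, …, x_{t-1}, a_{t-1}, x_t)` up to time `t`; here `B` stands for the
product of the action spaces. -/
abbrev History (X B : Type*) (t : ℕ) : Type _ := (Fin t → X × B) × X

section Strategies

variable {X : Type*} [MeasurableSpace X] {N : ℕ} {A : Fin N → Type*}
  [∀ i, MeasurableSpace (A i)] {p : ℕ}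

/-- The product `A(x)` of the sets of actions available to the players at `x`. -/
def GameModel.jointActions (G : GameModel X A p) (x : X) : Set (∀ i, A i) :=
  Set.univ.pi fun i => G.actions i x

/-- History-dependent policies of player `i`. -/
structure Policy (G : GameModel X A p) (i : Fin N) where
  kernel : ∀ t : ℕ, Kernel (History X (∀ j, A j) t) (A i)
  isMarkovKernel : ∀ t, IsMarkovKernel (kernel t)
  supported : ∀ t h, kernel t h (G.actions i h.2) = 1

attribute [instance] Policy.isMarkovKernel

/-- Correlated strategies. -/
structure CorrelatedStrategy (G : GameModel X A p) where
  kernel : ∀ t : ℕ, Kernel (History X (∀ j, A j) t) (∀ j, A j)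
  isMarkovKernel : ∀ t, IsMarkovKernel (kernel t)
  supported : ∀ t h, kernel t h (G.jointActions h.2) = 1

attribute [instance] CorrelatedStrategy.isMarkovKernel

/-- Correlated (stationary) Markov strategies. -/
structure CorrelatedMarkov (G : GameModel X A p) where
  kernel : Kernel X (∀ j, A j)
  isMarkovKernel : IsMarkovKernel kernel
  supported : ∀ x, kernel x (G.jointActions x) = 1

attribute [instance] CorrelatedMarkov.isMarkovKernel

/-- A correlated Markov strategy is a correlated strategy, which only looks at the current state. -/
noncomputable def CorrelatedMarkov.toStrategy {G : GameModel X A p} (π : CorrelatedMarkov G) :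
    CorrelatedStrategy G where
  kernel t := π.kernel.comap Prod.snd measurable_snd
  isMarkovKernel t := inferInstance
  supported t h := by rw [Kernel.comap_apply]; exact π.supported h.2

theorem measurable_measure_pi {Ω : Type*} [MeasurableSpace Ω] (κ : ∀ i, Kernel Ω (A i))
    [∀ i, IsMarkovKernel (κ i)] : Measurable fun ω => Measure.pi fun i => κ i ω := by
  refine Measurable.measure_of_isPiSystem_of_isProbabilityMeasure generateFrom_pi.symm
    isPiSystem_pi ?_
  rintro s ⟨u, hu, rfl⟩
  simp only [Measure.pi_pi]
  exact Finset.measurable_prod _ fun i _ =>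
    Kernel.measurable_coe (κ i) (hu i (Set.mem_univ i))

/-- A profile of policies is a correlated strategy: conditionally on the history, the players choose
their actions independently of each other. -/
noncomputable def toCorrelated {G : GameModel X A p} (π : ∀ i, Policy G i) :
    CorrelatedStrategy G where
  kernel t :=
    { toFun := fun h => Measure.pi fun i => (π i).kernel t h
      measurable' := measurable_measure_pi fun i => (π i).kernel t }
  isMarkovKernel t := ⟨fun h => by
    change IsProbabilityMeasure (Measure.pi fun i => (π i).kernel t h)
    infer_instance⟩
  supported t h := by
    change Measure.pi (fun i => (π i).kernel t h) (Set.univ.pi fun i => G.actions i h.2) = 1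
    rw [Measure.pi_pi]
    exact Finset.prod_eq_one fun i _ => (π i).supported t h

/-! ### The state-action process -/

/-- The history up to time `t + 1` made of `x_0, a_0, …, x_t, a_t` and of the next state. -/
def appendState (X B : Type*) (t : ℕ) (z : (Finset.Iic t → X × B) × X) : History X B (t + 1) :=
  (fun k => z.1 ⟨k, Finset.mem_Iic.2 (Nat.lt_succ_iff.1 k.2)⟩, z.2)

theorem measurable_appendState (X B : Type*) [MeasurableSpace X] [MeasurableSpace B] (t : ℕ) :
    Measurable (appendState X B t) := by
  unfold appendState
  fun_prop

/-- The conditional law of `(X_{t+1}, A_{t+1})` given `x_0, a_0, …, x_t, a_t`: the next state is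
drawn from `Q(· | x_t, a_t)`, the next action from `π_{t+1}(· | x_0, a_0, …, x_{t+1})`. -/
noncomputable def CorrelatedStrategy.step {G : GameModel X A p} (π : CorrelatedStrategy G) (t : ℕ) :
    Kernel (Finset.Iic t → X × (∀ j, A j)) (X × (∀ j, A j)) :=
  (G.Q.comap (fun h => h ⟨t, Finset.mem_Iic.2 le_rfl⟩) (by fun_prop)) ⊗ₖ
    ((π.kernel (t + 1)).comap (appendState X (∀ j, A j) t) (measurable_appendState X _ t))

instance {G : GameModel X A p} (π : CorrelatedStrategy G) (t : ℕ) : IsMarkovKernel (π.step t) := by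
  unfold CorrelatedStrategy.step
  infer_instance

/-- The law of `(X_0, A_0)`. -/
noncomputable def CorrelatedStrategy.initialLaw {G : GameModel X A p} (π : CorrelatedStrategy G)
    (η : Measure X) : Measure (X × (∀ j, A j)) :=
  η ⊗ₘ (π.kernel 0).comap (fun x => (Fin.elim0, x)) (by fun_prop)

/-- The strategic probability measure on the canonical space `(X × A)^ℕ` (Ionescu-Tulcea). -/
noncomputable def CorrelatedStrategy.law {G : GameModel X A p} (π : CorrelatedStrategy G)
    (η : Measure X) : Measure (ℕ → X × (∀ j, A j)) :=
  Kernel.trajMeasure (X := fun _ => X × (∀ j, A j)) (π.initialLaw η) π.step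

instance {G : GameModel X A p} (π : CorrelatedStrategy G) (η : Measure X)
    [IsProbabilityMeasure η] : IsProbabilityMeasure (π.law η) := by
  have : IsProbabilityMeasure (π.initialLaw η) := by
    unfold CorrelatedStrategy.initialLaw
    infer_instance
  unfold CorrelatedStrategy.law
  infer_instance

/-! ### Absorbing models -/

/-- The hitting time of `Δ` by the state process, equal to `⊤` when `Δ` is never reached. -/
noncomputable def hittingTime {X B : Type*} (Δ : Set X) (ω : ℕ → X × B) : ℕ∞ :=
  ⨅ (n : ℕ) (_ : (ω n).1 ∈ Δ), (n : ℕ∞)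

/-- The game with initial distribution `η` is absorbing to `Δ`. -/
structure IsAbsorbing (G : GameModel X A p) (η : Measure X) (Δ : Set X) : Prop where
  closed : ∀ x ∈ Δ, ∀ a, G.Q (x, a) Δ = 1
  reward_eq_zero : ∀ x ∈ Δ, ∀ a i, G.reward i (x, a) = 0
  cost_eq_zero : ∀ x ∈ Δ, ∀ a i j, G.cost i (x, a) j = 0
  expected_hittingTime : ∀ π : CorrelatedStrategy G,
    ∫⁻ ω, ((hittingTime Δ ω : ℕ∞) : ℝ≥0∞) ∂(π.law η) < ∞

/-- The game with initial distribution `η` is uniformly absorbing to `Δ`. -/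
structure IsUniformlyAbsorbing (G : GameModel X A p) (η : Measure X) (Δ : Set X) : Prop
    extends IsAbsorbing G η Δ where
  uniform_tail : Tendsto (fun n : ℕ => ⨆ π : CorrelatedMarkov G,
    ∑' t : ℕ, π.toStrategy.law η {ω | ((n + t : ℕ) : ℕ∞) < hittingTime Δ ω}) atTop (𝓝 0)

/-! ### Constraints and the standing assumption -/

/-- The total expected cost of player `i`, component `j`. -/
noncomputable def totalCost {G : GameModel X A p} (η : Measure X) (π : ∀ i, Policy G i)
    (i : Fin N) (j : Fin p) : ℝ :=
  ∫ ω, ∑' t : ℕ, G.cost i (ω t) j ∂((toCorrelated π).law η)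

/-- The Slater condition: against any policies of the other players, player `i` has a policy for
which all of his constraints hold strictly. -/
def Slater (G : GameModel X A p) (η : Measure X) (ρ : Fin N → Fin p → ℝ) : Prop :=
  ∀ (π : ∀ i, Policy G i) (i : Fin N), ∃ σ : Policy G i,
    ∀ j, ρ i j < totalCost η (Function.update π i σ) i j

/-- The standing assumption on the game with initial distribution `η` and constraint constants `ρ`,
with respect to the reference probability measure `lam` and the absorbing set `Δ`. -/
structure AssumptionA [∀ i, TopologicalSpace (A i)] (G : GameModel X A p) (η : Measure X)
    (ρ : Fin N → Fin p → ℝ) (lam : Measure X) (Δ : Set X) : Prop where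
  isProbabilityMeasure : IsProbabilityMeasure lam
  measurableSet : MeasurableSet Δ
  absorbing : IsAbsorbing G η Δ
  slater : Slater G η ρ
  countablyGenerated : MeasurableSpace.CountablyGenerated X
  compactSpace : ∀ i, CompactSpace (A i)
  isCompact_actions : ∀ i x, IsCompact (G.actions i x)
  /-- weak measurability of the action correspondences -/
  weaklyMeasurable : ∀ i, ∀ U : Set (A i), IsOpen U →
    MeasurableSet {x | (G.actions i x ∩ U).Nonempty}
  caratheodory_reward : ∀ i, IsBoundedCaratheodory (G.reward i)
  caratheodory_cost : ∀ i, IsBoundedCaratheodory (G.cost i)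
  /-- the transitions have a density which is continuous in the actions with respect to the
  `L¹`-norm -/
  density : ∃ q : X × X × (∀ j, A j) → ℝ≥0, Measurable q ∧
    (∀ x a (B : Set X), MeasurableSet B → G.Q (x, a) B = ∫⁻ y in B, (q (y, x, a) : ℝ≥0∞) ∂lam) ∧
    ∀ x (a : ∀ j, A j) (u : ℕ → ∀ j, A j), Tendsto u atTop (𝓝 a) →
      Tendsto (fun n => ∫ y, |(q (y, x, u n) : ℝ) - (q (y, x, a) : ℝ)| ∂lam) atTop (𝓝 0)
  absorbing_lam : IsAbsorbing G lam Δ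
  absolutelyContinuous : η ≪ lam

/-! ### Occupation measures -/

/-- The occupation measure `E ↦ 𝔼[∑_t 1{T_Δ > t} 1{(X_t, A_t) ∈ E}]`
(see `occupationMeasure_apply`). -/
noncomputable def occupationMeasure {G : GameModel X A p} (η : Measure X) (Δ : Set X)
    (π : CorrelatedStrategy G) : Measure (X × (∀ j, A j)) :=
  Measure.sum fun t : ℕ =>
    ((π.law η).restrict {ω | (t : ℕ∞) < hittingTime Δ ω}).map fun ω => ω t

theorem lt_hittingTime_iff {X B : Type*} (Δ : Set X) (ω : ℕ → X × B) (t : ℕ) :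
    (t : ℕ∞) < hittingTime Δ ω ↔ ∀ n ≤ t, (ω n).1 ∉ Δ := by
  rw [← not_iff_not, not_lt]
  push Not
  constructor
  · intro h
    by_contra hc
    push Not at hc
    have h1 : ((t + 1 : ℕ) : ℕ∞) ≤ hittingTime Δ ω :=
      le_iInf₂ fun n hn => by
        have : t < n := by
          by_contra h2
          exact hc n (not_lt.1 h2) hn
        exact_mod_cast this
    have h2 := h1.trans h
    have h3 : t + 1 ≤ t := by exact_mod_cast h2
    omega
  · rintro ⟨n, hn, hnΔ⟩
    exact (iInf₂_le n hnΔ).trans (by exact_mod_cast hn)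

theorem measurableSet_lt_hittingTime {X B : Type*} [MeasurableSpace X] [MeasurableSpace B]
    {Δ : Set X} (hΔ : MeasurableSet Δ) (t : ℕ) :
    MeasurableSet {ω : ℕ → X × B | (t : ℕ∞) < hittingTime Δ ω} := by
  simp only [lt_hittingTime_iff]
  have : {ω : ℕ → X × B | ∀ n ≤ t, (ω n).1 ∉ Δ} =
      ⋂ n ∈ Set.Iic t, (fun ω : ℕ → X × B => (ω n).1) ⁻¹' Δᶜ := by
    ext ω; simp
  rw [this]
  refine MeasurableSet.biInter (Set.to_countable _) fun n _ => ?_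
  exact (measurable_fst.comp (measurable_pi_apply n)) hΔ.compl

theorem occupationMeasure_apply {G : GameModel X A p} (η : Measure X) {Δ : Set X}
    (hΔ : MeasurableSet Δ) (π : CorrelatedStrategy G) {E : Set (X × (∀ j, A j))}
    (hE : MeasurableSet E) :
    occupationMeasure η Δ π E = ∫⁻ ω, ∑' t : ℕ,
      {ω : ℕ → X × (∀ j, A j) | (t : ℕ∞) < hittingTime Δ ω ∧ ω t ∈ E}.indicator 1 ω
        ∂(π.law η) := by
  have hm : ∀ t : ℕ, MeasurableSet
      {ω : ℕ → X × (∀ j, A j) | (t : ℕ∞) < hittingTime Δ ω ∧ ω t ∈ E} := fun t =>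
    (measurableSet_lt_hittingTime hΔ t).inter (measurable_pi_apply t hE)
  rw [lintegral_tsum fun t => (measurable_one.indicator (hm t)).aemeasurable,
    occupationMeasure, Measure.sum_apply _ hE]
  refine tsum_congr fun t => ?_
  rw [lintegral_indicator_one (hm t), Measure.map_apply (measurable_pi_apply t) hE,
    Measure.restrict_apply (measurable_pi_apply t hE), Set.inter_comm]
  rfl

/-- The total mass of the occupation measure is the expected hitting time; in particular the
occupation measures of an absorbing game are finite. -/
theorem occupationMeasure_univ {G : GameModel X A p} (η : Measure X) {Δ : Set X}
    (hΔ : MeasurableSet Δ) (π : CorrelatedStrategy G) :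
    occupationMeasure η Δ π Set.univ =
      ∫⁻ ω, ((hittingTime Δ ω : ℕ∞) : ℝ≥0∞) ∂(π.law η) := by
  rw [occupationMeasure_apply η hΔ π MeasurableSet.univ]
  refine lintegral_congr fun ω => ?_
  simp only [Set.mem_univ, and_true]
  induction hT : hittingTime Δ ω using ENat.recTopCoe with
  | top =>
    simp [Set.indicator, hT]
  | coe n =>
    rw [tsum_eq_sum (s := Finset.range n)]
    · rw [Finset.sum_congr rfl (g := fun _ => (1 : ℝ≥0∞))]
      · simp
      · intro t ht
        simp [Set.indicator, hT, Finset.mem_range.1 ht]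
    · intro t ht
      simp only [Finset.mem_range, not_lt] at ht
      simp [Set.indicator, hT, ht]

theorem isFiniteMeasure_occupationMeasure {G : GameModel X A p} {η : Measure X} {Δ : Set X}
    (hΔ : MeasurableSet Δ) (h : IsAbsorbing G η Δ) (π : CorrelatedStrategy G) :
    IsFiniteMeasure (occupationMeasure η Δ π) :=
  ⟨by rw [occupationMeasure_univ η hΔ π]; exact h.expected_hittingTime π⟩

/-- The set of the occupation measures of all correlated strategies. -/
def occupationSet (G : GameModel X A p) (η : Measure X) (Δ : Set X) :
    Set (FiniteMeasure (X × (∀ j, A j))) :=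
  {μ | ∃ π : CorrelatedStrategy G, (μ : Measure (X × (∀ j, A j))) = occupationMeasure η Δ π}

/-- The set of the `X × A i`-marginals of the occupation measures of all correlated strategies. -/
noncomputable def marginalOccupationSet (G : GameModel X A p) (η : Measure X) (Δ : Set X)
    (i : Fin N) : Set (FiniteMeasure (X × A i)) :=
  (fun μ : FiniteMeasure (X × (∀ j, A j)) => μ.map fun z => (z.1, z.2 i)) '' occupationSet G η Δ

end Strategies

end MarkovGame

/-! Occupation measures are described by a linear equation. A finite measure `μ` carried by the
graph of the available actions is an occupation measure if and only if its state marginal is the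
part of `η` outside `Δ` plus the one-step image of `μ` under `Q` killed in `Δ`; it then comes from a
Markov strategy (`IsCharacteristic.exists_markov`). Indeed, disintegrate `μ` by a Markov kernel: the
partial sums of the killed laws stay below `μ`, and the excess of `μ` over the occupation measure
solves the homogeneous equation. Such a solution gives a finite invariant measure outside `Δ`,
absolutely continuous with respect to `lam`. It vanishes because the game started from `lam` is
absorbed (`eq_zero_of_invariant`). Convexity follows from linearity.

(a) implies (b): identified through their Young measures `lam ⊗ₘ κ`, the Markov strategies form a
compact first countable space. The killed law at each fixed time depends continuously on the
strategy (`tendsto_integral_killedLaw`), since the transitions are continuous in the action for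
total variation. Uniform absorption makes the series of killed laws converge uniformly, so the
occupation set is a continuous image of a compact space. Metrizability of compact sets is automatic,
because countably many integrals separate measures. (b) implies (c) by continuity of the projection.

(c) implies (a): otherwise there are strategies `κ n` whose tail after time `n` has mass above some
`ε > 0`. Pass to an ultrafilter limit `κ0`. Compactness controls the state marginals, which suffices
for every tail to converge (`exists_tendsto_of_marginal_le`). The limit of the occupation measures
solves the characteristic equation and dominates the occupation measure of `κ0`, hence equals it. So
the tails of `κ0` all have mass at least `ε`, against absorption. Only the state marginals matter,
which is why a single player is enough. -/

set_option linter.unusedSectionVars false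

namespace MarkovGame

/-! ### Bounded Carathéodory functions as measurable maps into `C(B, ℝ)`. -/

section Caratheodory

variable {X : Type*} [MeasurableSpace X] {B : Type*} [TopologicalSpace B] [CompactSpace B]
  [TopologicalSpace.MetrizableSpace B] [SecondCountableTopology B]

theorem standardBorelSpace_of_compact [MeasurableSpace B] [BorelSpace B] :
    StandardBorelSpace B := by
  let := TopologicalSpace.metrizableSpaceMetric B
  infer_instance

/-- A measurable family of continuous functions on a compact metrizable space is strongly measurable
for the uniform norm. -/
theorem stronglyMeasurable_continuousMap {F : X → C(B, ℝ)} (hF : ∀ b, Measurable fun x => F x b) :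
    StronglyMeasurable F := by
  borelize C(B, ℝ)
  refine Measurable.stronglyMeasurable ?_
  cases isEmpty_or_nonempty B
  · have : F = fun _ => 0 := by
      ext x b; exact isEmptyElim b
    rw [this]; exact measurable_const
  -- Lusin–Souslin: a continuous injection between Polish spaces is a measurable embedding, so
  -- measurability can be tested at the points of a dense sequence.
  have he : MeasurableEmbedding fun (g : C(B, ℝ)) (n : ℕ) => g (TopologicalSpace.denseSeq B n) := by
    refine Continuous.measurableEmbedding
      (continuous_pi fun n => continuous_eval_const _) ?_
    intro g g' h
    refine DFunLike.coe_injective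
      ((TopologicalSpace.denseRange_denseSeq B).equalizer g.continuous g'.continuous ?_)
    exact h
  rw [← he.measurable_comp_iff]
  exact measurable_pi_iff.2 fun n => hF _

/-- A bounded Carathéodory function as a strongly measurable map into the continuous functions. -/
theorem IsBoundedCaratheodory.exists_continuousMap {f : X × B → ℝ} (hf : IsBoundedCaratheodory f) :
    ∃ F : X → C(B, ℝ), StronglyMeasurable F ∧ (∀ x b, F x b = f (x, b)) ∧
      ∃ C : ℝ, ∀ x, ‖F x‖ ≤ C := by
  obtain ⟨⟨h1, h2⟩, C, hC⟩ := hf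
  refine ⟨fun x => ⟨fun b => f (x, b), h2 x⟩, stronglyMeasurable_continuousMap h1,
    fun _ _ => rfl, max C 0, fun x => ?_⟩
  exact (ContinuousMap.norm_le _ (le_max_right _ _)).2 fun b => (hC (x, b)).trans (le_max_left _ _)

theorem measurable_uncurry_continuousMap [MeasurableSpace B] [BorelSpace B] {F : X → C(B, ℝ)}
    (hF : StronglyMeasurable F) : Measurable fun z : X × B => F z.1 z.2 := by
  borelize C(B, ℝ)
  have h : Measurable fun p : C(B, ℝ) × B => p.1 p.2 := continuous_eval.measurable
  exact h.comp ((hF.measurable.comp measurable_fst).prodMk measurable_snd)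

theorem isBoundedCaratheodory_uncurry {F : X → C(B, ℝ)} (hF : StronglyMeasurable F) {C : ℝ}
    (hC : ∀ x, ‖F x‖ ≤ C) : IsBoundedCaratheodory fun z : X × B => F z.1 z.2 := by
  borelize C(B, ℝ)
  refine ⟨⟨fun b => ?_, fun x => (F x).continuous⟩, C, fun z => ?_⟩
  · exact (continuous_eval_const b).measurable.comp hF.measurable
  · exact ((F z.1).norm_coe_le_norm z.2).trans (hC z.1)

theorem IsBoundedCaratheodory.measurable [MeasurableSpace B] [BorelSpace B] {f : X × B → ℝ}
    (hf : IsBoundedCaratheodory f) : Measurable f := by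
  obtain ⟨F, hF, hFf, -⟩ := hf.exists_continuousMap
  have : f = fun z : X × B => F z.1 z.2 := by ext z; rw [hFf]
  rw [this]; exact measurable_uncurry_continuousMap hF

theorem IsBoundedCaratheodory.integrable [MeasurableSpace B] [BorelSpace B] {f : X × B → ℝ}
    (hf : IsBoundedCaratheodory f) (μ : Measure (X × B)) [IsFiniteMeasure μ] :
    Integrable f μ := by
  obtain ⟨C, hC⟩ := hf.2
  exact Integrable.of_bound hf.measurable.aestronglyMeasurable C (Eventually.of_forall hC)

end Caratheodory

/-! ### Coding a countably generated space in the Cantor space. -/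

section Coding

variable (X : Type*) [MeasurableSpace X] [MeasurableSpace.CountablyGenerated X]

/-- The coordinates of the code are the indicators of a generating sequence of sets. The coding may
fail to be injective, but it loses no measurable set. -/
theorem comap_mapNatBool :
    MeasurableSpace.comap (MeasurableSpace.mapNatBool X) inferInstance = ‹MeasurableSpace X› := by
  refine le_antisymm (MeasurableSpace.measurable_mapNatBool X).comap_le ?_
  conv_lhs => rw [← MeasurableSpace.generateFrom_natGeneratingSequence X]
  refine MeasurableSpace.generateFrom_le ?_
  rintro _ ⟨n, rfl⟩
  refine ⟨{y | y n = true}, ?_, ?_⟩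
  · exact measurableSet_eq_fun (measurable_pi_apply n) measurable_const
  · ext x; simp [MeasurableSpace.mapNatBool]

variable {B : Type*} [MeasurableSpace B]

/-- The coding of `X × B` in the product of the Cantor space and `B`. -/
noncomputable def coding (B : Type*) : X × B → (ℕ → Bool) × B :=
  Prod.map (MeasurableSpace.mapNatBool X) id

theorem measurable_coding : Measurable (coding X B) :=
  ((MeasurableSpace.measurable_mapNatBool X).comp measurable_fst).prodMk measurable_snd

theorem comap_coding :
    MeasurableSpace.comap (coding X B) inferInstance =
      (inferInstance : MeasurableSpace (X × B)) := by
  refine le_antisymm (measurable_coding X).comap_le ?_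
  refine sup_le ?_ ?_
  · conv_lhs => rw [← comap_mapNatBool X]
    rw [MeasurableSpace.comap_comp]
    have : MeasurableSpace.mapNatBool X ∘ Prod.fst = Prod.fst ∘ coding X B := rfl
    rw [this, ← MeasurableSpace.comap_comp]
    exact MeasurableSpace.comap_mono measurable_fst.comap_le
  · have : (Prod.snd : X × B → B) = Prod.snd ∘ coding X B := rfl
    rw [this, ← MeasurableSpace.comap_comp]
    exact MeasurableSpace.comap_mono measurable_snd.comap_le

variable {X}

theorem eq_of_map_coding_eq {μ ν : Measure (X × B)} (h : μ.map (coding X B) = ν.map (coding X B)) :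
    μ = ν := by
  ext s hs
  obtain ⟨t, ht, rfl⟩ : MeasurableSet[MeasurableSpace.comap (coding X B) inferInstance] s := by
    rw [comap_coding X]; exact hs
  rw [← Measure.map_apply (measurable_coding X) ht, h, Measure.map_apply (measurable_coding X) ht]

end Coding

/-! ### Comparing measures through continuous functions. -/

section Limit

/-- A finite measure on a metrizable space which is dominated by another one on nonnegative bounded
continuous functions is dominated by it. -/
theorem measure_le_of_forall_integral_le {K : Type*} [TopologicalSpace K]
    [TopologicalSpace.PseudoMetrizableSpace K] [MeasurableSpace K] [BorelSpace K]
    {μ ν : Measure K} [IsFiniteMeasure μ] [IsFiniteMeasure ν]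
    (h : ∀ u : BoundedContinuousFunction K ℝ, (∀ k, 0 ≤ u k) → ∫ k, u k ∂μ ≤ ∫ k, u k ∂ν) :
    μ ≤ ν := by
  -- Closed sets suffice, by inner regularity of finite measures; their indicators are decreasing
  -- limits of continuous functions.
  have hF : ∀ F : Set K, IsClosed F → μ F ≤ ν F := by
    intro F hF
    refine ge_of_tendsto' (HasOuterApproxClosed.tendsto_lintegral_apprSeq hF ν) fun n => ?_
    refine (HasOuterApproxClosed.measure_le_lintegral hF μ n).trans ?_
    let u : BoundedContinuousFunction K ℝ := BoundedContinuousFunction.comp (fun r : ℝ≥0 => (r : ℝ))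
      NNReal.isometry_coe.lipschitz (hF.apprSeq n)
    have hu : ∀ (ρ : Measure K) [IsFiniteMeasure ρ],
        ∫⁻ x, hF.apprSeq n x ∂ρ = ENNReal.ofReal (∫ k, u k ∂ρ) := by
      intro ρ _
      rw [ofReal_integral_eq_lintegral_ofReal (u.integrable ρ)
        (Eventually.of_forall fun k => NNReal.coe_nonneg _)]
      refine lintegral_congr fun k => ?_
      exact (ENNReal.ofReal_coe_nnreal).symm
    rw [hu, hu]
    exact ENNReal.ofReal_le_ofReal (h u fun k => NNReal.coe_nonneg _)
  refine Measure.le_iff.2 fun s hs => ?_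
  rw [hs.measure_eq_iSup_isClosed_of_ne_top (measure_ne_top μ s)]
  exact iSup_le fun F => iSup_le fun hFs => iSup_le fun hFc => (hF F hFc).trans (measure_mono hFs)

end Limit

/-! ### Separation, metrizability and compactness for the `ws`-topology. -/

section WeakStrong

variable {X : Type*} [MeasurableSpace X] {B : Type*} [TopologicalSpace B] [MeasurableSpace B]

theorem tendsto_wsTopology_iff {J : Type*} {l : Filter J} {μ : J → FiniteMeasure (X × B)}
    {ν : FiniteMeasure (X × B)} :
    Tendsto μ l (@nhds _ (wsTopology X B) ν) ↔ ∀ f : X × B → ℝ, IsBoundedCaratheodory f →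
      Tendsto (fun j => ∫ z, f z ∂(μ j : Measure (X × B))) l
        (𝓝 (∫ z, f z ∂(ν : Measure (X × B)))) := by
  rw [wsTopology, nhds_iInf, tendsto_iInf]
  simp only [nhds_induced, tendsto_comap_iff, Subtype.forall]
  rfl

theorem continuous_integral_wsTopology {f : X × B → ℝ} (hf : IsBoundedCaratheodory f) :
    Continuous[wsTopology X B, inferInstance]
      fun μ : FiniteMeasure (X × B) => ∫ z, f z ∂(μ : Measure (X × B)) :=
  continuous_iInf_dom (i := (⟨f, hf⟩ : {f : X × B → ℝ // IsBoundedCaratheodory f}))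
    continuous_induced_dom

variable [CompactSpace B] [TopologicalSpace.MetrizableSpace B] [SecondCountableTopology B]
  [BorelSpace B]

/-- These functions link the `ws`-topology to weak convergence on the compact metrizable space `(ℕ →
Bool) × B`. -/
theorem isBoundedCaratheodory_comp_coding [MeasurableSpace.CountablyGenerated X]
    (u : C((ℕ → Bool) × B, ℝ)) : IsBoundedCaratheodory fun z : X × B => u (coding X B z) := by
  refine ⟨⟨fun b => ?_, fun x => ?_⟩, ‖u‖, fun z => u.norm_coe_le_norm _⟩
  · exact u.continuous.measurable.comp ((MeasurableSpace.measurable_mapNatBool X).prodMk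
      measurable_const)
  · exact u.continuous.comp (Continuous.prodMk_right _)

theorem map_coding_eq_of_integral_eq [MeasurableSpace.CountablyGenerated X] {μ ν : Measure (X × B)}
    [IsFiniteMeasure μ] [IsFiniteMeasure ν]
    (h : ∀ u : C((ℕ → Bool) × B, ℝ), ∫ z, u (coding X B z) ∂μ = ∫ z, u (coding X B z) ∂ν) :
    μ = ν := by
  refine eq_of_map_coding_eq ?_
  refine ext_of_forall_integral_eq_of_IsFiniteMeasure fun u => ?_
  rw [integral_map (measurable_coding X).aemeasurable u.continuous.measurable.aestronglyMeasurable,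
    integral_map (measurable_coding X).aemeasurable u.continuous.measurable.aestronglyMeasurable]
  exact h u.toContinuousMap

/-- Finite measures are determined by the integrals of the bounded Carathéodory functions. -/
theorem eq_of_forall_integral_caratheodory_eq [MeasurableSpace.CountablyGenerated X]
    {μ ν : Measure (X × B)} [IsFiniteMeasure μ] [IsFiniteMeasure ν]
    (h : ∀ f : X × B → ℝ, IsBoundedCaratheodory f → ∫ z, f z ∂μ = ∫ z, f z ∂ν) :
    μ = ν :=
  map_coding_eq_of_integral_eq fun u => h _ (isBoundedCaratheodory_comp_coding u)

/-- A continuous injection of a compact space into a Hausdorff space is an embedding. -/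
theorem metrizableSpace_of_continuous_injective {E : Type*} [TopologicalSpace E] [CompactSpace E]
    {e : E → ℕ → ℝ} (hc : Continuous e) (hi : Function.Injective e) :
    TopologicalSpace.MetrizableSpace E :=
  (hc.isClosedEmbedding hi).isEmbedding.metrizableSpace

/-- Compact sets of finite measures are metrizable for the `ws`-topology. -/
theorem isCompactMetrizable_of_compactSpace [MeasurableSpace.CountablyGenerated X]
    {s : Set (FiniteMeasure (X × B))}
    (hs : @CompactSpace s ((wsTopology X B).induced Subtype.val)) :
    IsCompactMetrizable (wsTopology X B) s := by
  refine ⟨hs, ?_⟩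
  let ws : TopologicalSpace (FiniteMeasure (X × B)) := wsTopology X B
  let t : TopologicalSpace s := ws.induced Subtype.val
  let U : ℕ → C((ℕ → Bool) × B, ℝ) := TopologicalSpace.denseSeq _
  refine @metrizableSpace_of_continuous_injective s t hs
    (fun μ n => ∫ z, U n (coding X B z) ∂((μ : FiniteMeasure (X × B)) : Measure (X × B))) ?_ ?_
  · refine continuous_pi fun n => ?_
    exact (continuous_integral_wsTopology (isBoundedCaratheodory_comp_coding (U n))).comp
      continuous_induced_dom
  · intro μ ν h
    have hμ : IsFiniteMeasure (μ.1 : Measure (X × B)) := μ.1.2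
    have hν : IsFiniteMeasure (ν.1 : Measure (X × B)) := ν.1.2
    suffices key : (μ.1 : Measure (X × B)) = ν.1 from Subtype.ext (Subtype.ext key)
    refine map_coding_eq_of_integral_eq ?_
    -- Integrals depend continuously on `u` for the uniform norm, so equality along the dense
    -- sequence extends to every `u`.
    have hcont : ∀ ρ : Measure (X × B), IsFiniteMeasure ρ →
        Continuous fun u : C((ℕ → Bool) × B, ℝ) => ∫ z, u (coding X B z) ∂ρ := by
      intro ρ _
      refine continuous_iff_continuousAt.2 fun u => ?_
      rw [ContinuousAt, tendsto_iff_norm_sub_tendsto_zero]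
      have hb : Tendsto (fun v : C((ℕ → Bool) × B, ℝ) => ‖v - u‖ * ρ.real Set.univ) (𝓝 u) (𝓝 0) := by
        have : Continuous fun v : C((ℕ → Bool) × B, ℝ) => ‖v - u‖ * ρ.real Set.univ := by fun_prop
        simpa using this.tendsto u
      refine squeeze_zero (fun _ => norm_nonneg _) (fun v => ?_) hb
      rw [← integral_sub ((isBoundedCaratheodory_comp_coding v).integrable ρ)
        ((isBoundedCaratheodory_comp_coding u).integrable ρ)]
      refine norm_integral_le_of_norm_le_const (Eventually.of_forall fun z => ?_)
      exact (v - u).norm_coe_le_norm _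
    intro u
    exact congrFun ((TopologicalSpace.denseRange_denseSeq _).equalizer
      (hcont _ hμ) (hcont _ hν) h) u

/-- A family of finite measures whose `X`-marginals are asymptotically dominated by a finite measure
along an ultrafilter converges in the `ws`-topology along that ultrafilter. -/
theorem exists_tendsto_of_marginal_le [MeasurableSpace.CountablyGenerated X] [Nonempty B]
    {J : Type*} (U : Ultrafilter J) (μ : J → Measure (X × B)) [∀ j, IsFiniteMeasure (μ j)]
    (ν : Measure X) [IsFiniteMeasure ν]
    (h : ∀ S : X → ℝ, Measurable S → (∃ C, ∀ x, S x ≤ C) → (∀ x, 0 ≤ S x) → ∀ ε > 0,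
      ∀ᶠ j in (U : Filter J), ∫ z, S z.1 ∂(μ j) ≤ ∫ x, S x ∂ν + ε) :
    ∃ μ0 : Measure (X × B), IsFiniteMeasure μ0 ∧ ∀ f : X × B → ℝ, IsBoundedCaratheodory f →
      Tendsto (fun j => ∫ z, f z ∂(μ j)) (U : Filter J) (𝓝 (∫ z, f z ∂μ0)) := by
  have hB : StandardBorelSpace B := standardBorelSpace_of_compact
  let φ : X → (ℕ → Bool) := MeasurableSpace.mapNatBool X
  have hφ : Measurable φ := MeasurableSpace.measurable_mapNatBool X
  have hΦ : Measurable (coding X B) := measurable_coding X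
  let m : J → FiniteMeasure ((ℕ → Bool) × B) := fun j => ⟨(μ j).map (coding X B), inferInstance⟩
  -- the weak limit of the coded measures
  obtain ⟨m0, hm0⟩ : ∃ m0 : FiniteMeasure ((ℕ → Bool) × B), Tendsto m U (𝓝 m0) := by
    -- Eventual bound on the masses, from the domination hypothesis with `S = 1` and `ε = 1`.
    let C : ℝ≥0 := (ν.real Set.univ + 1).toNNReal
    have hmem : ∀ᶠ j in (U : Filter J), m j ∈ {ρ : FiniteMeasure ((ℕ → Bool) × B) | ρ.mass ≤ C} := by
      filter_upwards [h (fun _ => 1) measurable_const ⟨1, fun _ => le_rfl⟩ (fun _ => zero_le_one) 1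
        one_pos] with j hj
      simp only [integral_const, smul_eq_mul, mul_one] at hj
      have h1 : ((m j).mass : ℝ) = (μ j).real Set.univ := by
        change ((μ j).map (coding X B)).real Set.univ = _
        rw [measureReal_def, Measure.map_apply hΦ MeasurableSet.univ]
        rfl
      change (m j).mass ≤ C
      rw [← NNReal.coe_le_coe, h1, Real.coe_toNNReal _ (by positivity)]
      exact hj
    obtain ⟨m0, -, hm0⟩ := isCompact_iff_ultrafilter_le_nhds.1
      (isCompact_setOfPred_finiteMeasure_le_of_compactSpace ((ℕ → Bool) × B) C) (U.map m)
      (by rw [Ultrafilter.coe_map]; exact tendsto_principal.2 hmem)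
    exact ⟨m0, hm0⟩
  rw [FiniteMeasure.tendsto_iff_forall_integral_tendsto] at hm0
  let M : Measure ((ℕ → Bool) × B) := m0
  have hm : ∀ (u : BoundedContinuousFunction ((ℕ → Bool) × B) ℝ) j,
      ∫ y, u y ∂(m j : Measure ((ℕ → Bool) × B)) = ∫ z, u (coding X B z) ∂(μ j) := fun u j =>
    integral_map hΦ.aemeasurable u.continuous.measurable.aestronglyMeasurable
  -- domination of the marginal of the limit
  have hle : M.map Prod.fst ≤ ν.map φ := by
    refine measure_le_of_forall_integral_le fun u hu => ?_
    rw [integral_map measurable_fst.aemeasurable u.continuous.measurable.aestronglyMeasurable,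
      integral_map hφ.aemeasurable u.continuous.measurable.aestronglyMeasurable]
    refine le_of_forall_pos_le_add fun ε hε => ?_
    refine le_of_tendsto (hm0 (u.compContinuous ⟨Prod.fst, continuous_fst⟩)) ?_
    filter_upwards [h (fun x => u (φ x)) (u.continuous.measurable.comp hφ)
      ⟨‖u‖, fun x => (le_abs_self _).trans (u.norm_coe_le_norm _)⟩ (fun x => hu _) ε hε] with j hj
    rw [hm]
    exact hj
  have hac : M.map Prod.fst ≪ ν.map φ := Measure.absolutelyContinuous_of_le hle
  -- the limit
  let d : (ℕ → Bool) → ℝ≥0∞ := (M.map Prod.fst).rnDeriv (ν.map φ)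
  have hd : Measurable d := Measure.measurable_rnDeriv _ _
  let κ : Kernel (ℕ → Bool) B := M.condKernel
  -- The weak limit lives on the code space and could charge codes of no point of `X`. Domination by
  -- `ν.map φ` gives its marginal a density, which can be pulled back to `X` along `φ`.
  have hMd : (ν.withDensity (d ∘ φ)).map φ = M.map Prod.fst := by
    rw [← Measure.withDensity_rnDeriv_eq _ _ hac]
    ext s hs
    rw [Measure.map_apply hφ hs, withDensity_apply _ (hφ hs), withDensity_apply _ hs,
      setLIntegral_map hs hd hφ]
    rfl
  have hfin : IsFiniteMeasure (ν.withDensity (d ∘ φ)) := by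
    refine ⟨?_⟩
    have := congrArg (fun ρ : Measure (ℕ → Bool) => ρ Set.univ) hMd
    simp only [Measure.map_apply hφ MeasurableSet.univ, Set.preimage_univ] at this
    rw [this]; exact measure_lt_top _ _
  let μ0 : Measure (X × B) := (ν.withDensity (d ∘ φ)) ⊗ₘ (κ.comap φ hφ)
  have hμ0 : μ0.map (coding X B) = M := by
    have hdis : (M.map Prod.fst) ⊗ₘ κ = M := M.disintegrate κ
    rw [← hdis, ← hMd]
    ext s hs
    rw [Measure.map_apply hΦ hs, Measure.compProd_apply (hΦ hs), Measure.compProd_apply hs,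
      lintegral_map (Kernel.measurable_kernel_prodMk_left hs) hφ]
    rfl
  refine ⟨μ0, inferInstance, fun f hf => ?_⟩
  obtain ⟨F, hF, hFf, C, hC⟩ := hf.exists_continuousMap
  -- Doob–Dynkin factorisation: the σ-algebra of `X` is the pullback of that of the code space.
  obtain ⟨F', hF', rfl⟩ : ∃ F' : (ℕ → Bool) → C(B, ℝ), StronglyMeasurable F' ∧ F = F' ∘ φ := by
    refine StronglyMeasurable.exists_eq_measurable_comp ?_
    rw [comap_mapNatBool X]; exact hF
  have hFi : Integrable F' (ν.map φ) := by
    rw [integrable_map_measure hF'.aestronglyMeasurable hφ.aemeasurable]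
    exact Integrable.of_bound hF.aestronglyMeasurable C (Eventually.of_forall hC)
  rw [Metric.tendsto_nhds]
  intro ε hε
  -- Replacing `F'` by the continuous `u` costs at most `ε / 5` at the limit and, eventually, `2 *
  -- (ε / 5)` along the family. Weak convergence for `u` costs another `ε / 5`, so the total is
  -- below `ε`.
  obtain ⟨u, hu, -⟩ := hFi.exists_boundedContinuous_integral_sub_le (ε := ε / 5) (by positivity)
  have hS : StronglyMeasurable fun k => ‖F' k - u k‖ :=
    (hF'.sub u.continuous.stronglyMeasurable).norm
  have hSν : ∫ x, ‖F' (φ x) - u (φ x)‖ ∂ν ≤ ε / 5 := by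
    rwa [integral_map hφ.aemeasurable hS.aestronglyMeasurable] at hu
  have hSC : ∀ x, ‖F' (φ x) - u (φ x)‖ ≤ C + ‖u‖ := fun x =>
    (norm_sub_le _ _).trans (add_le_add (hC x) (u.norm_coe_le_norm _))
  let v : BoundedContinuousFunction ((ℕ → Bool) × B) ℝ := BoundedContinuousFunction.mkOfCompact
    ⟨fun y => u y.1 y.2, (u.continuous.comp continuous_fst).eval continuous_snd⟩
  have hv := hm0 v
  have hvf : ∀ ρ : Measure (X × B), IsFiniteMeasure ρ →
      |∫ z, f z ∂ρ - ∫ z, v (coding X B z) ∂ρ| ≤ ∫ z, ‖F' (φ z.1) - u (φ z.1)‖ ∂ρ := by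
    intro ρ _
    have hsub := integral_sub (hf.integrable ρ)
      ((isBoundedCaratheodory_comp_coding v.toContinuousMap).integrable ρ)
    have hsub' : |∫ z, f z ∂ρ - ∫ z, v (coding X B z) ∂ρ| =
        ‖∫ z, (f z - v (coding X B z)) ∂ρ‖ := congrArg abs hsub.symm
    rw [hsub']
    refine norm_integral_le_of_norm_le ?_ (Eventually.of_forall fun z => ?_)
    · refine Integrable.of_bound
        (hS.measurable.comp (hφ.comp measurable_fst)).aestronglyMeasurable (C + ‖u‖)
        (Eventually.of_forall fun z => ?_)
      rw [norm_norm]; exact hSC z.1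
    · rw [← hFf z.1 z.2]
      exact (F' (φ z.1) - u (φ z.1)).norm_coe_le_norm z.2
  have h0 : |∫ z, f z ∂μ0 - ∫ y, v y ∂M| ≤ ε / 5 := by
    have h1 : ∫ y, v y ∂M = ∫ z, v (coding X B z) ∂μ0 := by
      rw [← hμ0]
      exact integral_map hΦ.aemeasurable v.continuous.measurable.aestronglyMeasurable
    rw [h1]
    refine (hvf μ0 inferInstance).trans ?_
    have h2 : ∫ z, ‖F' (φ z.1) - u (φ z.1)‖ ∂μ0 = ∫ k, ‖F' k - u k‖ ∂(M.map Prod.fst) := by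
      rw [← hμ0, Measure.map_map measurable_fst hΦ,
        integral_map (measurable_fst.comp hΦ).aemeasurable hS.aestronglyMeasurable]
      rfl
    rw [h2]
    refine (integral_mono_measure hle (Eventually.of_forall fun k => norm_nonneg _) ?_).trans hu
    exact (integrable_map_measure hS.aestronglyMeasurable hφ.aemeasurable).2
      (Integrable.of_bound (hS.measurable.comp hφ).aestronglyMeasurable (C + ‖u‖)
        (Eventually.of_forall fun x => by
          rw [Function.comp_apply, norm_norm]; exact hSC x))
  filter_upwards [Metric.tendsto_nhds.1 hv (ε / 5) (by positivity),
    h (fun x => ‖F' (φ x) - u (φ x)‖) (hS.measurable.comp hφ) ⟨_, hSC⟩ (fun x => norm_nonneg _)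
      (ε / 5) (by positivity)] with j hj1 hj2
  have h3 := hvf (μ j) inferInstance
  rw [hm, Real.dist_eq] at hj1
  rw [Real.dist_eq]
  have h4 : |∫ z, f z ∂(μ j) - ∫ z, v (coding X B z) ∂(μ j)| ≤ 2 * (ε / 5) := by linarith
  rw [abs_lt] at hj1 ⊢
  rw [abs_le] at h0 h4
  constructor <;> linarith [h0.1, h0.2, h4.1, h4.2, hj1.1, hj1.2]

end WeakStrong

/-! ### Recursion for the laws of the killed process. -/

section Laws

variable {X : Type*} [MeasurableSpace X] {N : ℕ} {A : Fin N → Type*}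
  [∀ i, MeasurableSpace (A i)] {p : ℕ} {G : GameModel X A p}

/-- The law of `(X_t, A_t)` on the event `{T_Δ > t}`. -/
noncomputable def killedLaw (η : Measure X) (Δ : Set X) (π : CorrelatedStrategy G) (t : ℕ) :
    Measure (X × (∀ j, A j)) :=
  ((π.law η).restrict {ω | (t : ℕ∞) < hittingTime Δ ω}).map fun ω => ω t

theorem occupationMeasure_eq_sum (η : Measure X) (Δ : Set X) (π : CorrelatedStrategy G) :
    occupationMeasure η Δ π = Measure.sum (killedLaw η Δ π) := rfl

instance (η : Measure X) [IsProbabilityMeasure η] (Δ : Set X) (π : CorrelatedStrategy G) (t : ℕ) :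
    IsFiniteMeasure (killedLaw η Δ π t) := by
  unfold killedLaw; infer_instance

/-- The trajectory measure starts from functions on the one-point index set `Iic 0`, which have to
be identified with their single value. -/
theorem map_law_zero (η : Measure X) [IsProbabilityMeasure η] (π : CorrelatedStrategy G) :
    (π.law η).map (fun ω => ω 0) = π.initialLaw η := by
  have h1 : (π.law η).map (Preorder.frestrictLe 0) =
      (π.initialLaw η).map (MeasurableEquiv.piUnique
        (fun _ : Finset.Iic 0 => X × (∀ j, A j))).symm := by
    unfold CorrelatedStrategy.law Kernel.trajMeasure
    rw [Measure.map_comp _ _ (by fun_prop), Kernel.traj_map_frestrictLe, Kernel.partialTraj_self,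
      Measure.id_comp]
  have h2 : (fun ω : ℕ → X × (∀ j, A j) => ω 0) =
      (MeasurableEquiv.piUnique (fun _ : Finset.Iic 0 => X × (∀ j, A j))) ∘
        (Preorder.frestrictLe 0) := rfl
  rw [h2, ← Measure.map_map (by fun_prop) (by fun_prop), h1, Measure.map_map (by fun_prop)
    (by fun_prop)]
  have h3 : (MeasurableEquiv.piUnique (fun _ : Finset.Iic 0 => X × (∀ j, A j))) ∘
      (MeasurableEquiv.piUnique (fun _ : Finset.Iic 0 => X × (∀ j, A j))).symm = id :=
    funext fun x => MeasurableEquiv.apply_symm_apply _ x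
  rw [h3, Measure.map_id]

theorem lintegral_killedLaw {η : Measure X} {Δ : Set X}
    (π : CorrelatedStrategy G) (t : ℕ) {f : X × (∀ j, A j) → ℝ≥0∞} (hf : Measurable f) :
    ∫⁻ z, f z ∂(killedLaw η Δ π t) =
      ∫⁻ ω in {ω | (t : ℕ∞) < hittingTime Δ ω}, f (ω t) ∂(π.law η) := by
  rw [killedLaw, lintegral_map hf (measurable_pi_apply t)]

theorem lintegral_killedLaw_zero {η : Measure X} [IsProbabilityMeasure η] {Δ : Set X}
    (hΔ : MeasurableSet Δ) (π : CorrelatedStrategy G) {f : X × (∀ j, A j) → ℝ≥0∞}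
    (hf : Measurable f) :
    ∫⁻ z, f z ∂(killedLaw η Δ π 0) =
      ∫⁻ x in Δᶜ, ∫⁻ a, f (x, a) ∂(π.kernel 0 (Fin.elim0, x)) ∂η := by
  have h0 : {ω : ℕ → X × (∀ j, A j) | ((0 : ℕ) : ℕ∞) < hittingTime Δ ω} =
      (fun ω => ω 0) ⁻¹' (Prod.fst ⁻¹' Δᶜ) := by
    ext ω
    rw [Set.mem_ofPred_eq, lt_hittingTime_iff]
    simp
  have hs : MeasurableSet (Prod.fst ⁻¹' Δᶜ : Set (X × (∀ j, A j))) := measurable_fst hΔ.compl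
  rw [lintegral_killedLaw π 0 hf, h0, ← setLIntegral_map hs hf (measurable_pi_apply 0),
    map_law_zero, CorrelatedStrategy.initialLaw]
  have h1 : (Prod.fst ⁻¹' Δᶜ : Set (X × (∀ j, A j))) = Δᶜ ×ˢ Set.univ := by ext; simp
  rw [h1, Measure.setLIntegral_compProd hf hΔ.compl MeasurableSet.univ]
  simp only [Measure.restrict_univ, Kernel.comap_apply]

theorem lintegral_killedLaw_succ {η : Measure X} [IsProbabilityMeasure η] {Δ : Set X}
    (hΔ : MeasurableSet Δ) (π : CorrelatedStrategy G) (t : ℕ) {f : X × (∀ j, A j) → ℝ≥0∞}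
    (hf : Measurable f) :
    ∫⁻ z, f z ∂(killedLaw η Δ π (t + 1)) =
      ∫⁻ ω in {ω | (t : ℕ∞) < hittingTime Δ ω}, ∫⁻ y in Δᶜ, ∫⁻ a, f (y, a)
        ∂(π.kernel (t + 1) (appendState X (∀ j, A j) t (Preorder.frestrictLe t ω, y)))
          ∂(G.Q (ω t)) ∂(π.law η) := by
  let H : Set (Finset.Iic t → X × (∀ j, A j)) := {h | ∀ k, (h k).1 ∉ Δ}
  have hH : MeasurableSet H := by
    have : H = ⋂ k, (fun h : Finset.Iic t → X × (∀ j, A j) => (h k).1) ⁻¹' Δᶜ := by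
      ext; simp [H]
    rw [this]
    exact MeasurableSet.iInter fun k => (measurable_fst.comp (measurable_pi_apply k)) hΔ.compl
  have hs : MeasurableSet (Prod.fst ⁻¹' Δᶜ : Set (X × (∀ j, A j))) := measurable_fst hΔ.compl
  have h1 : {ω : ℕ → X × (∀ j, A j) | ((t + 1 : ℕ) : ℕ∞) < hittingTime Δ ω} =
      (fun ω => (Preorder.frestrictLe t ω, ω (t + 1))) ⁻¹' (H ×ˢ (Prod.fst ⁻¹' Δᶜ)) := by
    ext ω
    rw [Set.mem_ofPred_eq, lt_hittingTime_iff]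
    simp only [Set.mem_preimage, Set.mem_prod, H, Set.mem_ofPred_eq, Set.mem_compl_iff]
    constructor
    · intro h
      exact ⟨fun k => h k.1 ((Finset.mem_Iic.1 k.2).trans (Nat.le_succ t)), h _ le_rfl⟩
    · rintro ⟨h, h'⟩ n hn
      rcases Nat.le_succ_iff.1 hn with hn | rfl
      · exact h ⟨n, Finset.mem_Iic.2 hn⟩
      · exact h'
  have h2 : {ω : ℕ → X × (∀ j, A j) | (t : ℕ∞) < hittingTime Δ ω} =
      (Preorder.frestrictLe t) ⁻¹' H := by
    ext ω
    rw [Set.mem_ofPred_eq, lt_hittingTime_iff]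
    exact ⟨fun h k => h k.1 (Finset.mem_Iic.1 k.2), fun h n hn => h ⟨n, Finset.mem_Iic.2 hn⟩⟩
  have hprob : IsProbabilityMeasure (π.initialLaw η) := by
    unfold CorrelatedStrategy.initialLaw; infer_instance
  -- Defining property of the Ionescu-Tulcea measure: given the past, the next pair follows `π.step
  -- t`.
  have hlaw : (π.law η).map (fun ω => (Preorder.frestrictLe t ω, ω (t + 1))) =
      (π.law η).map (Preorder.frestrictLe t) ⊗ₘ π.step t :=
    (Kernel.map_frestrictLe_trajMeasure_compProd_eq_map_trajMeasure
      (X := fun _ => X × (∀ j, A j)) (μ₀ := π.initialLaw η) (κ := π.step) (a := t)).symm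
  let e : (ℕ → X × (∀ j, A j)) → (Finset.Iic t → X × (∀ j, A j)) × (X × (∀ j, A j)) :=
    fun ω => (Preorder.frestrictLe t ω, ω (t + 1))
  have he : Measurable e := by fun_prop
  have hmap := setLIntegral_map (μ := π.law η) (hH.prod hs) (hf.comp measurable_snd) he
  rw [lintegral_killedLaw π _ hf, h1]
  refine hmap.symm.trans ?_
  rw [hlaw, Measure.setLIntegral_compProd (hf.comp measurable_snd) hH hs, h2]
  have hmeas : Measurable fun h => ∫⁻ z in Prod.fst ⁻¹' Δᶜ, f z ∂(π.step t h) :=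
    (hf.setLIntegral_kernel hs)
  refine (setLIntegral_map hH hmeas (by fun_prop)).trans ?_
  refine lintegral_congr fun ω => ?_
  have h3 : (Prod.fst ⁻¹' Δᶜ : Set (X × (∀ j, A j))) = Δᶜ ×ˢ Set.univ := by ext; simp
  rw [CorrelatedStrategy.step, h3, Kernel.setLIntegral_compProd _ _ _ hf hΔ.compl MeasurableSet.univ]
  simp only [Measure.restrict_univ, Kernel.comap_apply]
  rfl

/-- The killed transitions of the state marginals. -/
theorem fst_killedLaw_zero {η : Measure X} [IsProbabilityMeasure η] {Δ : Set X}
    (hΔ : MeasurableSet Δ) (π : CorrelatedStrategy G) :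
    (killedLaw η Δ π 0).fst = η.restrict Δᶜ := by
  ext s hs
  rw [Measure.fst_apply hs, ← lintegral_indicator_one (measurable_fst hs),
    lintegral_killedLaw_zero hΔ π (measurable_one.indicator (measurable_fst hs)),
    ← lintegral_indicator_one hs]
  refine lintegral_congr fun x => ?_
  have : ∀ a : ∀ j, A j, (Prod.fst ⁻¹' s).indicator (1 : X × (∀ j, A j) → ℝ≥0∞) (x, a) =
      s.indicator 1 x := fun a => rfl
  simp [this]

/-- The next action integrates to one, so the history disappears: the recursion holds for every
correlated strategy, Markov or not. -/
theorem fst_killedLaw_succ {η : Measure X} [IsProbabilityMeasure η] {Δ : Set X}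
    (hΔ : MeasurableSet Δ) (π : CorrelatedStrategy G) (t : ℕ) :
    (killedLaw η Δ π (t + 1)).fst = (G.Q ∘ₘ killedLaw η Δ π t).restrict Δᶜ := by
  ext s hs
  rw [Measure.fst_apply hs, ← lintegral_indicator_one (measurable_fst hs),
    lintegral_killedLaw_succ hΔ π t (measurable_one.indicator (measurable_fst hs)),
    Measure.restrict_apply hs, Measure.bind_apply (hs.inter hΔ.compl) G.Q.aemeasurable,
    lintegral_killedLaw π t (Kernel.measurable_coe _ (hs.inter hΔ.compl))]
  refine lintegral_congr fun ω => ?_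
  have : ∀ x (a : ∀ j, A j), (Prod.fst ⁻¹' s).indicator (1 : X × (∀ j, A j) → ℝ≥0∞) (x, a) =
      s.indicator 1 x := fun x a => rfl
  simp only [this, lintegral_const, measure_univ, mul_one]
  rw [lintegral_indicator_one hs, Measure.restrict_apply hs]

/-- Under a Markov strategy the actions are drawn from the kernel. -/
theorem killedLaw_toStrategy {η : Measure X} [IsProbabilityMeasure η] {Δ : Set X}
    (hΔ : MeasurableSet Δ) (κ : CorrelatedMarkov G) (t : ℕ) :
    killedLaw η Δ κ.toStrategy t = (killedLaw η Δ κ.toStrategy t).fst ⊗ₘ κ.kernel := by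
  ext s hs
  have hm : Measurable fun x => κ.kernel x (Prod.mk x ⁻¹' s) :=
    Kernel.measurable_kernel_prodMk_left hs
  have hk : ∀ x, ∫⁻ a, s.indicator (1 : X × (∀ j, A j) → ℝ≥0∞) (x, a) ∂(κ.kernel x) =
      κ.kernel x (Prod.mk x ⁻¹' s) := fun x =>
    lintegral_indicator_one (measurable_prodMk_left hs)
  rw [← lintegral_indicator_one hs, Measure.compProd_apply hs]
  cases t with
  | zero =>
    rw [fst_killedLaw_zero hΔ, lintegral_killedLaw_zero hΔ _ (measurable_one.indicator hs)]
    exact lintegral_congr hk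
  | succ t =>
    rw [fst_killedLaw_succ hΔ, lintegral_killedLaw_succ hΔ _ t (measurable_one.indicator hs),
      ← lintegral_indicator hΔ.compl, Measure.lintegral_bind G.Q.aemeasurable
        (hm.indicator hΔ.compl).aemeasurable, lintegral_killedLaw _ t
        ((hm.indicator hΔ.compl).lintegral_kernel)]
    refine lintegral_congr fun ω => ?_
    rw [lintegral_indicator hΔ.compl]
    exact lintegral_congr hk

/-- A measurable property of the actions which holds for all available actions holds almost surely. -/
theorem ae_killedLaw {η : Measure X} [IsProbabilityMeasure η] {Δ : Set X}
    (hΔ : MeasurableSet Δ) (π : CorrelatedStrategy G) {S : Set (X × (∀ j, A j))}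
    (hS : MeasurableSet S) (h : ∀ x, ∀ a ∈ G.jointActions x, (x, a) ∈ S) (t : ℕ) :
    killedLaw η Δ π t Sᶜ = 0 := by
  have h0 : ∀ t (k : History X (∀ j, A j) t),
      ∫⁻ a, Sᶜ.indicator (1 : X × (∀ j, A j) → ℝ≥0∞) (k.2, a) ∂(π.kernel t k) = 0 := by
    intro t k
    have hm : MeasurableSet (Prod.mk k.2 ⁻¹' S) := measurable_prodMk_left hS
    have h1 : (π.kernel t k) (Prod.mk k.2 ⁻¹' S) = 1 := by
      refine le_antisymm prob_le_one ?_
      rw [← π.supported t k]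
      exact measure_mono fun a ha => h k.2 a ha
    have h2 := (prob_compl_eq_zero_iff hm).2 h1
    rw [← Set.preimage_compl, ← lintegral_indicator_one (measurable_prodMk_left hS.compl)] at h2
    exact h2
  rw [← lintegral_indicator_one hS.compl]
  cases t with
  | zero =>
    rw [lintegral_killedLaw_zero hΔ _ (measurable_one.indicator hS.compl)]
    have := fun x => h0 0 (Fin.elim0, x)
    simp only at this
    simp [this]
  | succ t =>
    rw [lintegral_killedLaw_succ hΔ _ t (measurable_one.indicator hS.compl)]
    have := fun (ω : ℕ → X × (∀ j, A j)) y => h0 (t + 1)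
      (appendState X (∀ j, A j) t (Preorder.frestrictLe t ω, y))
    simp only [appendState] at this
    simp only [appendState, this]
    simp

end Laws

/-! ### The killed transition operator and its invariant measures. -/

section Killed

variable {X : Type*} [MeasurableSpace X] {N : ℕ} {A : Fin N → Type*}
  [∀ i, MeasurableSpace (A i)] {p : ℕ} {G : GameModel X A p}

theorem add_right_cancel_measure {Ω : Type*} [MeasurableSpace Ω] {α β s : Measure Ω}
    [IsFiniteMeasure s] (h : α + s = β + s) : α = β := by
  ext t ht
  have := congrArg (fun m : Measure Ω => m t) h
  simp only [Measure.add_apply] at this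
  exact (ENNReal.add_left_inj (measure_ne_top s t)).1 this

theorem bind_mono_left {Ω Ω' : Type*} [MeasurableSpace Ω] [MeasurableSpace Ω'] (K : Kernel Ω Ω')
    {μ ν : Measure Ω} (h : μ ≤ ν) : K ∘ₘ μ ≤ K ∘ₘ ν := by
  refine Measure.le_iff.2 fun s hs => ?_
  rw [Measure.bind_apply hs K.aemeasurable, Measure.bind_apply hs K.aemeasurable]
  exact lintegral_mono' h le_rfl

theorem compProd_mono_left {Ω Ω' : Type*} [MeasurableSpace Ω] [MeasurableSpace Ω']
    (K : Kernel Ω Ω') [IsSFiniteKernel K] {μ ν : Measure Ω} [SFinite μ] [SFinite ν] (h : μ ≤ ν) :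
    μ ⊗ₘ K ≤ ν ⊗ₘ K := by
  refine Measure.le_iff.2 fun s hs => ?_
  rw [Measure.compProd_apply hs, Measure.compProd_apply hs]
  exact lintegral_mono' h le_rfl

variable (G) in
/-- The law of the next state on the event that it is outside `Δ`. -/
noncomputable def killedNext (Δ : Set X) (μ : Measure (X × (∀ j, A j))) : Measure X :=
  (G.Q ∘ₘ μ).restrict Δᶜ

instance (Δ : Set X) (μ : Measure (X × (∀ j, A j))) [IsFiniteMeasure μ] :
    IsFiniteMeasure (killedNext G Δ μ) := by
  unfold killedNext; infer_instance

theorem killedNext_add (Δ : Set X) (μ ν : Measure (X × (∀ j, A j))) :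
    killedNext G Δ (μ + ν) = killedNext G Δ μ + killedNext G Δ ν := by
  rw [killedNext, Measure.comp_add, Measure.restrict_add]; rfl

theorem killedNext_smul (Δ : Set X) (c : ℝ≥0∞) (μ : Measure (X × (∀ j, A j))) :
    killedNext G Δ (c • μ) = c • killedNext G Δ μ := by
  rw [killedNext, Measure.comp_smul, Measure.restrict_smul]; rfl

theorem killedNext_mono (Δ : Set X) {μ ν : Measure (X × (∀ j, A j))} (h : μ ≤ ν) :
    killedNext G Δ μ ≤ killedNext G Δ ν :=
  Measure.restrict_mono le_rfl (bind_mono_left G.Q h)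

theorem lintegral_killedNext {Δ : Set X} (hΔ : MeasurableSet Δ) (μ : Measure (X × (∀ j, A j)))
    {g : X → ℝ≥0∞} (hg : Measurable g) :
    ∫⁻ y, g y ∂(killedNext G Δ μ) = ∫⁻ z, ∫⁻ y in Δᶜ, g y ∂(G.Q z) ∂μ := by
  rw [killedNext, ← lintegral_indicator hΔ.compl,
    Measure.lintegral_bind G.Q.aemeasurable (hg.indicator hΔ.compl).aemeasurable]
  simp only [lintegral_indicator hΔ.compl]

/-- The probability of avoiding `Δ` for `n` further steps under a Markov strategy. -/
noncomputable def survival (Δ : Set X) (κ : CorrelatedMarkov G) : ℕ → X → ℝ≥0∞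
  | 0 => fun _ => 1
  | n + 1 => fun x => ∫⁻ a, ∫⁻ y in Δᶜ, survival Δ κ n y ∂(G.Q (x, a)) ∂(κ.kernel x)

theorem measurable_survival {Δ : Set X} (hΔ : MeasurableSet Δ) (κ : CorrelatedMarkov G) (n : ℕ) :
    Measurable (survival Δ κ n) := by
  induction n with
  | zero => exact measurable_const
  | succ n ih =>
    have h1 : Measurable fun z : X × (∀ j, A j) => ∫⁻ y in Δᶜ, survival Δ κ n y ∂(G.Q z) :=
      ih.setLIntegral_kernel hΔ.compl
    exact h1.lintegral_kernel_prod_right' (κ := κ.kernel)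

theorem survival_succ_le (Δ : Set X) (κ : CorrelatedMarkov G) (n : ℕ) (x : X) :
    survival Δ κ (n + 1) x ≤ survival Δ κ n x := by
  induction n generalizing x with
  | zero =>
    simp only [survival, lintegral_const, one_mul]
    calc ∫⁻ a, (G.Q (x, a)).restrict Δᶜ Set.univ ∂(κ.kernel x)
        ≤ ∫⁻ _, 1 ∂(κ.kernel x) := lintegral_mono fun a => by
          rw [Measure.restrict_apply_univ]; exact prob_le_one
      _ = 1 := by simp
  | succ n ih =>
    exact lintegral_mono fun a => lintegral_mono fun y => ih y

/-- Duality: a backward step on the survival function is a forward killed step on the measure. -/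
theorem lintegral_survival_succ {Δ : Set X} (hΔ : MeasurableSet Δ) (κ : CorrelatedMarkov G) (n : ℕ)
    (m : Measure X) [SFinite m] :
    ∫⁻ x, survival Δ κ (n + 1) x ∂m =
      ∫⁻ x, survival Δ κ n x ∂(killedNext G Δ (m ⊗ₘ κ.kernel)) := by
  rw [lintegral_killedNext hΔ _ (measurable_survival hΔ κ n), Measure.lintegral_compProd
    ((measurable_survival hΔ κ n).setLIntegral_kernel hΔ.compl)]
  rfl

theorem lintegral_survival_fst_killedLaw {η : Measure X} [IsProbabilityMeasure η] {Δ : Set X}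
    (hΔ : MeasurableSet Δ) (κ : CorrelatedMarkov G) (n t : ℕ) :
    ∫⁻ x, survival Δ κ n x ∂(killedLaw η Δ κ.toStrategy t).fst =
      killedLaw η Δ κ.toStrategy (t + n) Set.univ := by
  induction n generalizing t with
  | zero => simp [survival, Measure.fst_univ]
  | succ n ih =>
    rw [lintegral_survival_succ hΔ, ← killedLaw_toStrategy hΔ, killedNext, ← fst_killedLaw_succ hΔ,
      ih, Nat.add_right_comm, Nat.add_assoc]

/-- Every `Q (x, a)` has a density, so one step suffices whatever the measure `μ` is. -/
theorem killedNext_absolutelyContinuous [∀ i, TopologicalSpace (A i)] {η lam : Measure X}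
    {Δ : Set X} {ρ : Fin N → Fin p → ℝ} (hA : AssumptionA G η ρ lam Δ)
    (μ : Measure (X × (∀ j, A j))) : killedNext G Δ μ ≪ lam := by
  obtain ⟨q, hq, hQ, -⟩ := hA.density
  refine (Measure.absolutelyContinuous_of_le Measure.restrict_le_self).trans ?_
  refine Measure.AbsolutelyContinuous.mk fun s hs h0 => ?_
  rw [Measure.bind_apply hs G.Q.aemeasurable]
  have : ∀ z, G.Q z s = 0 := fun z => by
    rw [hQ z.1 z.2 s hs, Measure.restrict_zero_set h0, lintegral_zero_measure]
  simp [this]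

/-- There is no nonzero finite invariant measure outside `Δ` for a Markov strategy. -/
theorem eq_zero_of_invariant [∀ i, TopologicalSpace (A i)] {η lam : Measure X}
    {Δ : Set X} {ρ : Fin N → Fin p → ℝ} (hA : AssumptionA G η ρ lam Δ) (κ : CorrelatedMarkov G)
    (m : Measure X) [IsFiniteMeasure m] (hm : m = killedNext G Δ (m ⊗ₘ κ.kernel)) : m = 0 := by
  have hΔ := hA.measurableSet
  have hlam := hA.isProbabilityMeasure
  -- By invariance, the process started from `m` loses no mass. Started from `lam`, however,
  -- survival tends to zero almost everywhere outside `Δ`, and `m` is absolutely continuous there.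
  have hmn : ∀ n, ∫⁻ x, survival Δ κ n x ∂m = m Set.univ := by
    intro n
    induction n with
    | zero => simp [survival]
    | succ n ih => rw [lintegral_survival_succ hΔ, ← hm, ih]
  have hanti : Antitone fun n => survival Δ κ n :=
    antitone_nat_of_succ_le fun n x => survival_succ_le Δ κ n x
  have hlim0 : Tendsto (fun n => ∫⁻ x, survival Δ κ n x ∂(lam.restrict Δᶜ)) atTop (𝓝 0) := by
    have h1 : ∀ n, ∫⁻ x, survival Δ κ n x ∂(lam.restrict Δᶜ) =
        killedLaw lam Δ κ.toStrategy n Set.univ := fun n => by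
      rw [← fst_killedLaw_zero hΔ κ.toStrategy, lintegral_survival_fst_killedLaw hΔ, zero_add]
    simp only [h1]
    refine ENNReal.tendsto_atTop_zero_of_tsum_ne_top ?_
    have h2 := occupationMeasure_univ lam hΔ κ.toStrategy
    rw [occupationMeasure_eq_sum, Measure.sum_apply _ MeasurableSet.univ] at h2
    rw [h2]
    exact (hA.absorbing_lam.expected_hittingTime κ.toStrategy).ne
  have hmeas : ∀ n, Measurable (survival Δ κ n) := measurable_survival hΔ κ
  have hae : ∀ᵐ x ∂(lam.restrict Δᶜ), ⨅ n, survival Δ κ n x = 0 := by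
    have h0 : ∫⁻ x, ⨅ n, survival Δ κ n x ∂(lam.restrict Δᶜ) = 0 := by
      refine le_antisymm (ge_of_tendsto' hlim0 fun n => ?_) zero_le
      exact lintegral_mono fun x => iInf_le _ n
    exact (lintegral_eq_zero_iff (Measurable.iInf hmeas)).1 h0
  have hac : m ≪ lam.restrict Δᶜ := by
    have h1 : m = m.restrict Δᶜ := by
      conv_rhs => rw [hm, killedNext, Measure.restrict_restrict hΔ.compl, Set.inter_self]
      exact hm
    rw [h1]
    refine Measure.AbsolutelyContinuous.restrict ?_ _
    rw [hm]
    exact killedNext_absolutelyContinuous hA _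
  have h2 : ∫⁻ x, ⨅ n, survival Δ κ n x ∂m = m Set.univ := by
    rw [lintegral_iInf hmeas hanti (by rw [hmn]; exact measure_ne_top _ _)]
    simp [hmn]
  rw [lintegral_congr_ae (hac.ae_le hae), lintegral_zero] at h2
  exact Measure.measure_univ_eq_zero.1 h2.symm

end Killed

/-! ### The characteristic equation and the occupation measures. -/

section Graph

variable {X : Type*} [MeasurableSpace X] {N : ℕ} {A : Fin N → Type*}
  [∀ i, MetricSpace (A i)] [∀ i, CompactSpace (A i)] [∀ i, SecondCountableTopology (A i)]
  [∀ i, MeasurableSpace (A i)] [∀ i, BorelSpace (A i)] {p : ℕ} {G : GameModel X A p}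
  {η lam : Measure X} {Δ : Set X} {ρ : Fin N → Fin p → ℝ}

variable (G) in
/-- The graph of the correspondence of the available actions. -/
def graphSet : Set (X × (∀ j, A j)) := {z | z.2 ∈ G.jointActions z.1}

theorem isBoundedCaratheodory_infDist (hA : AssumptionA G η ρ lam Δ) (i : Fin N) :
    IsBoundedCaratheodory fun z : X × (∀ j, A j) => Metric.infDist (z.2 i) (G.actions i z.1) := by
  refine ⟨⟨fun a => ?_, fun x => ?_⟩, Metric.diam (Set.univ : Set (A i)), fun z => ?_⟩
  · refine measurable_of_Iio fun r => ?_
    -- Distance to the action set below `r` means that the action set meets an open ball, which is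
    -- where weak measurability enters.
    have : (fun x => Metric.infDist (a i) (G.actions i x)) ⁻¹' Set.Iio r =
        {x | (G.actions i x ∩ Metric.ball (a i) r).Nonempty} := by
      ext x
      simp only [Set.mem_preimage, Set.mem_Iio, Metric.infDist_lt_iff (G.actions_nonempty i x)]
      exact ⟨fun ⟨y, h1, h2⟩ => ⟨y, h1, by rwa [Metric.mem_ball']⟩,
        fun ⟨y, h1, h2⟩ => ⟨y, h1, by rwa [Metric.mem_ball'] at h2⟩⟩
    rw [this]
    exact hA.weaklyMeasurable i _ Metric.isOpen_ball
  · exact (Metric.continuous_infDist_pt (G.actions i x)).comp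
      (continuous_apply (A := fun j => A j) i)
  · rw [Real.norm_of_nonneg Metric.infDist_nonneg]
    obtain ⟨y, hy⟩ := G.actions_nonempty i z.1
    exact (Metric.infDist_le_dist_of_mem hy).trans
      (Metric.dist_le_diam_of_mem isCompact_univ.isBounded (Set.mem_univ _) (Set.mem_univ _))

theorem graphSet_eq (hA : AssumptionA G η ρ lam Δ) :
    graphSet G = ⋂ i, {z | Metric.infDist (z.2 i) (G.actions i z.1) = 0} := by
  ext z
  simp only [graphSet, GameModel.jointActions, Set.mem_ofPred_eq, Set.mem_univ_pi, Set.mem_iInter]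
  refine forall_congr' fun i => ?_
  exact (hA.isCompact_actions i z.1).isClosed.mem_iff_infDist_zero (G.actions_nonempty i z.1)

theorem measurableSet_graphSet (hA : AssumptionA G η ρ lam Δ) : MeasurableSet (graphSet G) := by
  rw [graphSet_eq hA]
  exact MeasurableSet.iInter fun i =>
    measurableSet_eq_fun (isBoundedCaratheodory_infDist hA i).measurable measurable_const

/-- Expresses concentration on the graph by integrals of Carathéodory functions, so that it passes
to `ws`-limits. -/
theorem measure_compl_graphSet_eq_zero_iff (hA : AssumptionA G η ρ lam Δ)
    (μ : Measure (X × (∀ j, A j))) [IsFiniteMeasure μ] :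
    μ (graphSet G)ᶜ = 0 ↔
      ∀ i, ∫ z, Metric.infDist (z.2 i) (G.actions i z.1) ∂μ = 0 := by
  have h1 : ∀ i, ∫ z, Metric.infDist (z.2 i) (G.actions i z.1) ∂μ = 0 ↔
      μ {z | Metric.infDist (z.2 i) (G.actions i z.1) = 0}ᶜ = 0 := fun i =>
    integral_eq_zero_iff_of_nonneg (fun z => Metric.infDist_nonneg)
      ((isBoundedCaratheodory_infDist hA i).integrable μ)
  simp only [h1]
  rw [graphSet_eq hA, Set.compl_iInter, measure_iUnion_null_iff]

theorem killedLaw_compl_graphSet [IsProbabilityMeasure η] {ν : Measure X} [IsProbabilityMeasure ν]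
    (hA : AssumptionA G η ρ lam Δ) (π : CorrelatedStrategy G) (t : ℕ) :
    killedLaw ν Δ π t (graphSet G)ᶜ = 0 :=
  ae_killedLaw hA.measurableSet π (measurableSet_graphSet hA) (fun _ _ ha => ha) t

/-- Disintegration of a measure on the graph by a Markov strategy. -/
theorem exists_markov_disintegration [Nonempty (∀ j, A j)] (hA : AssumptionA G η ρ lam Δ)
    (π : CorrelatedStrategy G)
    (τ : Measure (X × (∀ j, A j))) [IsFiniteMeasure τ] (hτ : τ (graphSet G)ᶜ = 0) :
    ∃ κ : CorrelatedMarkov G, τ = τ.fst ⊗ₘ κ.kernel := by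
  classical
  have hB : StandardBorelSpace (∀ j, A j) := standardBorelSpace_of_compact
  have hS := measurableSet_graphSet hA
  -- The conditional kernel is admissible only almost everywhere. On the exceptional set the initial
  -- decision of `π` replaces it, in lieu of a measurable selection.
  let k : Kernel X (∀ j, A j) := (π.kernel 0).comap (fun x => (Fin.elim0, x)) (by fun_prop)
  have hk : ∀ x, k x (G.jointActions x) = 1 := fun x => π.supported 0 (Fin.elim0, x)
  let D : Set X := {x | τ.condKernel x (Prod.mk x ⁻¹' (graphSet G)ᶜ) = 0}
  have hD : MeasurableSet D :=
    measurableSet_eq_fun (Kernel.measurable_kernel_prodMk_left hS.compl) measurable_const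
  have hdis : τ.fst ⊗ₘ τ.condKernel = τ := τ.disintegrate _
  have hae : ∀ᵐ x ∂τ.fst, x ∈ D := by
    rw [← hdis, Measure.compProd_apply hS.compl, lintegral_eq_zero_iff
      (Kernel.measurable_kernel_prodMk_left hS.compl)] at hτ
    exact hτ
  let K : Kernel X (∀ j, A j) := Kernel.piecewise hD τ.condKernel k
  refine ⟨⟨K, inferInstance, fun x => ?_⟩, ?_⟩
  · by_cases hx : x ∈ D
    · have h1 : K x = τ.condKernel x := if_pos hx
      rw [h1]
      have hx' : τ.condKernel x (G.jointActions x)ᶜ = 0 := hx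
      exact (prob_compl_eq_zero_iff (measurable_prodMk_left (x := x) hS)).1 hx'
    · have h1 : K x = k x := if_neg hx
      rw [h1]; exact hk x
  · conv_lhs => rw [← hdis]
    refine Measure.compProd_congr ?_
    filter_upwards [hae] with x hx
    exact (if_pos hx).symm

/-- The characteristic equation of the occupation measures. -/
structure IsCharacteristic (G : GameModel X A p) (η : Measure X) (Δ : Set X)
    (μ : Measure (X × (∀ j, A j))) : Prop where
  fst_eq : μ.fst = η.restrict Δᶜ + killedNext G Δ μ
  graph : μ (graphSet G)ᶜ = 0

theorem fst_sum (μ : ℕ → Measure (X × (∀ j, A j))) :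
    (Measure.sum μ).fst = Measure.sum fun n => (μ n).fst := by
  ext s hs
  rw [Measure.fst_apply hs, Measure.sum_apply _ (measurable_fst hs), Measure.sum_apply _ hs]
  exact tsum_congr fun n => (Measure.fst_apply hs).symm

theorem killedNext_sum (hΔ : MeasurableSet Δ) (μ : ℕ → Measure (X × (∀ j, A j))) :
    killedNext G Δ (Measure.sum μ) = Measure.sum fun n => killedNext G Δ (μ n) := by
  ext s hs
  rw [Measure.sum_apply _ hs]
  simp only [killedNext, Measure.restrict_apply hs,
    Measure.bind_apply (hs.inter hΔ.compl) G.Q.aemeasurable, lintegral_sum_measure]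

theorem isCharacteristic_occupationMeasure [IsProbabilityMeasure η] (hA : AssumptionA G η ρ lam Δ)
    (π : CorrelatedStrategy G) : IsCharacteristic G η Δ (occupationMeasure η Δ π) := by
  have hΔ := hA.measurableSet
  refine ⟨?_, ?_⟩
  · rw [occupationMeasure_eq_sum, fst_sum, killedNext_sum hΔ]
    ext s hs
    rw [Measure.sum_apply _ hs, Measure.add_apply, Measure.sum_apply _ hs,
      tsum_eq_zero_add' ENNReal.summable, fst_killedLaw_zero hΔ]
    congr 1
    exact tsum_congr fun t => by rw [fst_killedLaw_succ hΔ]; rfl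
  · rw [occupationMeasure_eq_sum, Measure.sum_apply _ (measurableSet_graphSet hA).compl]
    simp [killedLaw_compl_graphSet hA]

/-- Disintegrating `τ` by a Markov strategy makes its state marginal an invariant measure. -/
theorem eq_zero_of_fst_eq_killedNext [Nonempty (∀ j, A j)] (hA : AssumptionA G η ρ lam Δ)
    (π : CorrelatedStrategy G) (τ : Measure (X × (∀ j, A j))) [IsFiniteMeasure τ]
    (hτ : τ.fst = killedNext G Δ τ) (hg : τ (graphSet G)ᶜ = 0) : τ = 0 := by
  obtain ⟨κ, hκ⟩ := exists_markov_disintegration hA π τ hg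
  have : τ.fst = 0 := eq_zero_of_invariant hA κ τ.fst (by rw [← hκ]; exact hτ)
  rw [hκ, this]
  simp

/-- An occupation measure which is dominated by a solution of the characteristic equation is equal
to it. -/
theorem IsCharacteristic.eq_of_le [IsProbabilityMeasure η] [Nonempty (∀ j, A j)]
    (hA : AssumptionA G η ρ lam Δ) {μ : Measure (X × (∀ j, A j))} [IsFiniteMeasure μ]
    (hμ : IsCharacteristic G η Δ μ) (π : CorrelatedStrategy G)
    (hle : occupationMeasure η Δ π ≤ μ) : μ = occupationMeasure η Δ π := by
  have hfin : IsFiniteMeasure (occupationMeasure η Δ π) :=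
    isFiniteMeasure_occupationMeasure hA.measurableSet hA.absorbing π
  let s := occupationMeasure η Δ π
  have hs := isCharacteristic_occupationMeasure hA π
  have hsub : (μ - s) + s = μ := Measure.sub_add_cancel_of_le hle
  -- Both measures solve the same affine equation, so their difference solves the homogeneous one.
  have h0 : μ - s = 0 := by
    refine eq_zero_of_fst_eq_killedNext hA π _ ?_ ?_
    · refine add_right_cancel_measure (s := s.fst) ?_
      have h1 : (μ - s).fst + s.fst = μ.fst := by
        rw [← Measure.fst_add, hsub]
      rw [h1, hμ.fst_eq, hs.fst_eq, ← add_assoc, add_comm (killedNext G Δ (μ - s)), add_assoc,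
        ← killedNext_add, hsub]
    · exact Measure.absolutelyContinuous_of_le Measure.sub_le hμ.graph
  rw [← hsub, h0, zero_add]

theorem occupationMeasure_le_of_sum_le {ν : Measure X} (π : CorrelatedStrategy G)
    {μ : Measure (X × (∀ j, A j))}
    (h : ∀ n, ∑ t ∈ Finset.range n, killedLaw ν Δ π t ≤ μ) : occupationMeasure ν Δ π ≤ μ := by
  refine Measure.le_iff.2 fun s hs => ?_
  rw [occupationMeasure_eq_sum, Measure.sum_apply _ hs]
  refine ENNReal.tsum_le_of_sum_range_le fun n => ?_
  rw [← Measure.finsetSum_apply]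
  exact h n s

/-- The partial sums are the iterates from zero of a monotone affine map. A characteristic measure
disintegrated by `κ` is a fixed point of this map and hence bounds all iterates. -/
theorem sum_killedLaw_succ [IsProbabilityMeasure η] (hΔ : MeasurableSet Δ) (κ : CorrelatedMarkov G)
    (n : ℕ) :
    ∑ t ∈ Finset.range (n + 1), killedLaw η Δ κ.toStrategy t =
      (η.restrict Δᶜ + killedNext G Δ (∑ t ∈ Finset.range n, killedLaw η Δ κ.toStrategy t)) ⊗ₘ
        κ.kernel := by
  induction n with
  | zero =>
    rw [Finset.sum_range_one, Finset.sum_range_zero, killedLaw_toStrategy hΔ, fst_killedLaw_zero hΔ]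
    simp [killedNext]
  | succ n ih =>
    conv_rhs => rw [Finset.sum_range_succ, killedNext_add, ← add_assoc,
      Measure.compProd_add_left _ (killedNext G Δ (killedLaw η Δ κ.toStrategy n)), ← ih]
    rw [Finset.sum_range_succ]
    congr 1
    rw [killedLaw_toStrategy hΔ, fst_killedLaw_succ hΔ]; rfl

/-- The finite solutions of the characteristic equation are the occupation measures of the Markov
strategies. -/
theorem IsCharacteristic.exists_markov [IsProbabilityMeasure η] [Nonempty (∀ j, A j)]
    (hA : AssumptionA G η ρ lam Δ) (π : CorrelatedStrategy G) {μ : Measure (X × (∀ j, A j))}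
    [IsFiniteMeasure μ] (hμ : IsCharacteristic G η Δ μ) :
    ∃ κ : CorrelatedMarkov G, μ = occupationMeasure η Δ κ.toStrategy := by
  obtain ⟨κ, hκ⟩ := exists_markov_disintegration hA π μ hμ.graph
  refine ⟨κ, hμ.eq_of_le hA _ (occupationMeasure_le_of_sum_le _ fun n => ?_)⟩
  induction n with
  | zero => simpa using Measure.zero_le μ
  | succ n ih =>
    rw [sum_killedLaw_succ hA.measurableSet]
    conv_rhs => rw [hκ, hμ.fst_eq]
    exact compProd_mono_left _ (add_le_add le_rfl (killedNext_mono _ ih))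

end Graph

/-! ### Changing the reference measure and the integrand in limits of kernels. -/

section Base

variable {X : Type*} [MeasurableSpace X] {B : Type*} [TopologicalSpace B] [CompactSpace B]
  [TopologicalSpace.MetrizableSpace B] [SecondCountableTopology B]
  [MeasurableSpace B] [BorelSpace B]

theorem integral_comp_measure {Ω Ω' : Type*} [MeasurableSpace Ω] [MeasurableSpace Ω']
    (K : Kernel Ω Ω') {μ : Measure Ω} {f : Ω' → ℝ} (hf : Integrable f (K ∘ₘ μ)) :
    ∫ y, f y ∂(K ∘ₘ μ) = ∫ z, ∫ y, f y ∂(K z) ∂μ := by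
  rw [Measure.comp_eq_comp_const_apply] at hf ⊢
  rw [Kernel.integral_comp hf]
  simp

theorem tendsto_integral_min {lam : Measure X} {φ : X → ℝ} (hφ : Integrable φ lam)
    (h0 : ∀ x, 0 ≤ φ x) :
    Tendsto (fun n : ℕ => ∫ x, (φ x - min (φ x) n) ∂lam) atTop (𝓝 0) := by
  have : Tendsto (fun n : ℕ => ∫ x, (φ x - min (φ x) n) ∂lam) atTop (𝓝 (∫ _, (0 : ℝ) ∂lam)) := by
    refine tendsto_integral_of_dominated_convergence φ (fun n => ?_) hφ (fun n => ?_) ?_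
    · exact (hφ.aestronglyMeasurable.aemeasurable.sub
        (hφ.aestronglyMeasurable.aemeasurable.min aemeasurable_const)).aestronglyMeasurable
    · refine Eventually.of_forall fun x => ?_
      rw [Real.norm_of_nonneg (sub_nonneg.2 (min_le_left _ _))]
      have : 0 ≤ min (φ x) n := le_min (h0 x) (Nat.cast_nonneg n)
      linarith
    · refine Eventually.of_forall fun x => ?_
      obtain ⟨K, hK⟩ := exists_nat_ge (φ x)
      refine tendsto_const_nhds.congr' ?_
      filter_upwards [eventually_ge_atTop K] with n hn
      rw [min_eq_left (hK.trans (by exact_mod_cast hn)), sub_self]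
  simpa using this

/-- Convergence of the kernels with respect to the reference measure implies convergence with respect
to every absolutely continuous finite measure. -/
theorem tendsto_integral_compProd_of_absolutelyContinuous {lam : Measure X} [IsFiniteMeasure lam]
    {k : ℕ → Kernel X B} [∀ n, IsMarkovKernel (k n)] {k0 : Kernel X B} [IsMarkovKernel k0]
    (h : ∀ f : X × B → ℝ, IsBoundedCaratheodory f →
      Tendsto (fun n => ∫ z, f z ∂(lam ⊗ₘ k n)) atTop (𝓝 (∫ z, f z ∂(lam ⊗ₘ k0))))
    {m : Measure X} [IsFiniteMeasure m] (hm : m ≪ lam) {f : X × B → ℝ}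
    (hf : IsBoundedCaratheodory f) :
    Tendsto (fun n => ∫ z, f z ∂(m ⊗ₘ k n)) atTop (𝓝 (∫ z, f z ∂(m ⊗ₘ k0))) := by
  obtain ⟨C, hC⟩ := hf.2
  let φ : X → ℝ := fun x => (m.rnDeriv lam x).toReal
  have hφm : Measurable φ := (Measure.measurable_rnDeriv m lam).ennreal_toReal
  have hφ0 : ∀ x, 0 ≤ φ x := fun x => ENNReal.toReal_nonneg
  have hφi : Integrable φ lam := Measure.integrable_toReal_rnDeriv
  let v : Kernel X B → X → ℝ := fun K x => ∫ b, f (x, b) ∂(K x)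
  have hvm : ∀ K : Kernel X B, IsMarkovKernel K → Measurable (v K) := fun K _ =>
    (hf.measurable.stronglyMeasurable.integral_kernel_prod_right' (κ := K)).measurable
  have hvC : ∀ K : Kernel X B, IsMarkovKernel K → ∀ x, ‖v K x‖ ≤ C := fun K _ x => by
    refine (norm_integral_le_of_norm_le_const (Eventually.of_forall fun b => hC (x, b))).trans ?_
    simp
  have hC0 : ∀ x : X, 0 ≤ C := fun x => (norm_nonneg _).trans (hvC k0 inferInstance x)
  have hI : ∀ K : Kernel X B, IsMarkovKernel K →
      ∫ z, f z ∂(m ⊗ₘ K) = ∫ x, φ x * v K x ∂lam := fun K _ => by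
    rw [Measure.integral_compProd (hf.integrable _), ← integral_rnDeriv_smul hm]
    rfl
  -- The density `φ` need not be bounded, so `φ * f` is not an admissible test function. The
  -- truncation is one, and its error is uniform in the kernel.
  have hbc : ∀ n : ℕ, IsBoundedCaratheodory fun z : X × B => min (φ z.1) n * f z := fun n => by
    refine ⟨⟨fun b => (hφm.min measurable_const).mul (hf.1.1 b),
      fun x => (continuous_const (y := min (φ x) n)).mul (hf.1.2 x)⟩, n * C, fun z => ?_⟩
    rw [norm_mul]
    refine mul_le_mul ?_ (hC z) (norm_nonneg _) (Nat.cast_nonneg n)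
    rw [Real.norm_of_nonneg (le_min (hφ0 _) (Nat.cast_nonneg n))]
    exact min_le_right _ _
  have hIn : ∀ n : ℕ, ∀ K : Kernel X B, IsMarkovKernel K →
      ∫ z, min (φ z.1) n * f z ∂(lam ⊗ₘ K) = ∫ x, min (φ x) n * v K x ∂lam := fun n K _ => by
    rw [Measure.integral_compProd ((hbc n).integrable _)]
    refine integral_congr_ae (Eventually.of_forall fun x => ?_)
    exact integral_const_mul (min (φ x) n) fun b => f (x, b)
  have hmini : ∀ n : ℕ, Integrable (fun x => min (φ x) n) lam := fun n =>
    hφi.mono' (hφm.min measurable_const).aestronglyMeasurable (Eventually.of_forall fun x => by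
      rw [Real.norm_of_nonneg (le_min (hφ0 _) (Nat.cast_nonneg n))]
      exact min_le_left _ _)
  have hdiff : ∀ n : ℕ, ∀ K : Kernel X B, IsMarkovKernel K →
      |∫ z, f z ∂(m ⊗ₘ K) - ∫ z, min (φ z.1) n * f z ∂(lam ⊗ₘ K)| ≤
        C * ∫ x, (φ x - min (φ x) n) ∂lam := fun n K hK => by
    rw [hI K hK, hIn n K hK, ← integral_sub
      (hφi.mul_bdd (hvm K hK).aestronglyMeasurable (Eventually.of_forall (hvC K hK)))
      ((hmini n).mul_bdd (hvm K hK).aestronglyMeasurable (Eventually.of_forall (hvC K hK))),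
      ← integral_const_mul]
    have hint : Integrable (fun x => C * (φ x - min (φ x) n)) lam :=
      (hφi.sub (hmini n)).const_mul C
    rw [← Real.norm_eq_abs]
    refine norm_integral_le_of_norm_le hint
      (Eventually.of_forall fun x => ?_)
    rw [← sub_mul, norm_mul, mul_comm, Real.norm_of_nonneg (sub_nonneg.2 (min_le_left (φ x) n))]
    exact mul_le_mul_of_nonneg_right (hvC K hK x) (sub_nonneg.2 (min_le_left _ _))
  rw [Metric.tendsto_nhds]
  intro ε hε
  have hlim : Tendsto (fun n : ℕ => C * ∫ x, (φ x - min (φ x) n) ∂lam) atTop (𝓝 0) := by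
    simpa using (tendsto_integral_min hφi hφ0).const_mul C
  obtain ⟨K, hK⟩ := ((tendsto_order.1 hlim).2 (ε / 3) (by positivity)).exists
  filter_upwards [Metric.tendsto_nhds.1 (h _ (hbc K)) (ε / 3) (by positivity)] with n hn
  have h1 := (hdiff K (k n) inferInstance).trans_lt hK
  have h2 := (hdiff K k0 inferInstance).trans_lt hK
  rw [Real.dist_eq] at hn ⊢
  rw [abs_lt] at h1 h2 hn ⊢
  constructor <;> linarith [h1.1, h1.2, h2.1, h2.2, hn.1, hn.2]

/-- Lets the integrand vary with `n`: as the kernels are Markov, the error is at most the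
`m`-integral of the uniform distance, which tends to zero by dominated convergence. -/
theorem tendsto_integral_compProd {lam : Measure X} [IsFiniteMeasure lam]
    {k : ℕ → Kernel X B} [∀ n, IsMarkovKernel (k n)] {k0 : Kernel X B} [IsMarkovKernel k0]
    (h : ∀ f : X × B → ℝ, IsBoundedCaratheodory f →
      Tendsto (fun n => ∫ z, f z ∂(lam ⊗ₘ k n)) atTop (𝓝 (∫ z, f z ∂(lam ⊗ₘ k0))))
    {m : Measure X} [IsFiniteMeasure m] (hm : m ≪ lam) {F : ℕ → X → C(B, ℝ)} {F0 : X → C(B, ℝ)}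
    (hF : ∀ n, StronglyMeasurable (F n)) (hF0 : StronglyMeasurable F0) {C : ℝ}
    (hC : ∀ n x, ‖F n x‖ ≤ C) (hC0 : ∀ x, ‖F0 x‖ ≤ C)
    (hlim : ∀ x, Tendsto (fun n => F n x) atTop (𝓝 (F0 x))) :
    Tendsto (fun n => ∫ z, F n z.1 z.2 ∂(m ⊗ₘ k n)) atTop
      (𝓝 (∫ z, F0 z.1 z.2 ∂(m ⊗ₘ k0))) := by
  have h1 := tendsto_integral_compProd_of_absolutelyContinuous h hm
    (isBoundedCaratheodory_uncurry hF0 hC0)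
  have h2 : Tendsto (fun n => ∫ x, ‖F n x - F0 x‖ ∂m) atTop (𝓝 0) := by
    have : Tendsto (fun n => ∫ x, ‖F n x - F0 x‖ ∂m) atTop (𝓝 (∫ _, (0 : ℝ) ∂m)) := by
      refine tendsto_integral_of_dominated_convergence (fun _ => C + C)
        (fun n => ((hF n).sub hF0).norm.aestronglyMeasurable) (integrable_const _) (fun n => ?_) ?_
      · refine Eventually.of_forall fun x => ?_
        rw [norm_norm]
        exact (norm_sub_le _ _).trans (add_le_add (hC n x) (hC0 x))
      · exact Eventually.of_forall fun x => tendsto_iff_norm_sub_tendsto_zero.1 (hlim x)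
    simpa using this
  refine tendsto_of_tendsto_of_dist h1 (squeeze_zero (fun _ => dist_nonneg) (fun n => ?_) h2)
  have hi1 := (isBoundedCaratheodory_uncurry (hF n) (hC n)).integrable (m ⊗ₘ k n)
  have hi0 := (isBoundedCaratheodory_uncurry hF0 hC0).integrable (m ⊗ₘ k n)
  have hb : ∀ x, ‖F n x - F0 x‖ ≤ C + C := fun x =>
    (norm_sub_le _ _).trans (add_le_add (hC n x) (hC0 x))
  have hm1 : StronglyMeasurable fun x => ‖F n x - F0 x‖ := ((hF n).sub hF0).norm
  have hi2 : Integrable (fun z : X × B => ‖F n z.1 - F0 z.1‖) (m ⊗ₘ k n) :=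
    Integrable.of_bound (hm1.measurable.comp measurable_fst).aestronglyMeasurable (C + C)
      (Eventually.of_forall fun z => by rw [norm_norm]; exact hb z.1)
  have h3 : ∫ z, ‖F n z.1 - F0 z.1‖ ∂(m ⊗ₘ k n) = ∫ x, ‖F n x - F0 x‖ ∂m := by
    rw [Measure.integral_compProd hi2]
    simp
  rw [dist_comm, Real.dist_eq, ← integral_sub hi1 hi0, ← h3]
  exact norm_integral_le_of_norm_le hi2 (Eventually.of_forall fun z =>
    (F n z.1 - F0 z.1).norm_coe_le_norm z.2)

end Base

/-! ### Continuity of the killed laws in the strategy. -/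

section Transition

variable {X : Type*} [MeasurableSpace X] {N : ℕ} {A : Fin N → Type*}
  [∀ i, MetricSpace (A i)] [∀ i, CompactSpace (A i)] [∀ i, SecondCountableTopology (A i)]
  [∀ i, MeasurableSpace (A i)] [∀ i, BorelSpace (A i)] {p : ℕ} {G : GameModel X A p}
  {η lam : Measure X} {Δ : Set X} {ρ : Fin N → Fin p → ℝ}

variable (G) in
/-- The expected value of `V` at the next state, on the event that it is outside `Δ`. -/
noncomputable def nextValue (Δ : Set X) (V : X → ℝ) (z : X × (∀ j, A j)) : ℝ :=
  ∫ y in Δᶜ, V y ∂(G.Q z)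

theorem abs_nextValue_le {V : X → ℝ} {C : ℝ} (hC : ∀ x, ‖V x‖ ≤ C) (z : X × (∀ j, A j)) :
    ‖nextValue G Δ V z‖ ≤ C := by
  have hC0 : 0 ≤ C := (norm_nonneg _).trans (hC z.1)
  refine (norm_integral_le_of_norm_le_const (Eventually.of_forall hC)).trans ?_
  refine mul_le_of_le_one_right hC0 ?_
  rw [measureReal_restrict_apply_univ]
  exact measureReal_le_one

/-- The transitions depend continuously on the actions for the total variation norm. -/
theorem exists_dist_nextValue_le (hA : AssumptionA G η ρ lam Δ) (x : X) (a : ∀ j, A j) :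
    ∃ d : (∀ j, A j) → ℝ, Tendsto d (𝓝 a) (𝓝 0) ∧ ∀ (V : X → ℝ) (C : ℝ), Measurable V →
      (∀ x, ‖V x‖ ≤ C) → ∀ b, |nextValue G Δ V (x, b) - nextValue G Δ V (x, a)| ≤ C * d b := by
  obtain ⟨q, hq, hQ, hcont⟩ := hA.density
  have hΔ := hA.measurableSet
  -- This modulus does not depend on `V`: it gives equicontinuity in the action for all value
  -- functions with a common bound.
  refine ⟨fun b => ∫ y, |(q (y, x, b) : ℝ) - (q (y, x, a) : ℝ)| ∂lam, ?_, ?_⟩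
  · exact tendsto_of_seq_tendsto fun u hu => hcont x a u hu
  intro V C hV hC b
  have hqm : ∀ b, Measurable fun y => q (y, x, b) := fun b =>
    hq.comp (measurable_id.prodMk measurable_const)
  have hQd : ∀ b, G.Q (x, b) = lam.withDensity fun y => (q (y, x, b) : ℝ≥0∞) := fun b => by
    ext s hs
    rw [hQ x b s hs, withDensity_apply _ hs]
  have hqi : ∀ b, Integrable (fun y => (q (y, x, b) : ℝ)) lam := fun b => by
    refine ⟨(hqm b).coe_nnreal_real.aestronglyMeasurable, ?_⟩
    rw [HasFiniteIntegral]
    have h1 : ∫⁻ y, (q (y, x, b) : ℝ≥0∞) ∂lam = 1 := by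
      rw [← setLIntegral_univ, ← hQ x b _ MeasurableSet.univ, measure_univ]
    simp only [NNReal.enorm_eq]
    rw [h1]; exact ENNReal.one_lt_top
  have hval : ∀ b, nextValue G Δ V (x, b) =
      ∫ y, (q (y, x, b) : ℝ) * Δᶜ.indicator V y ∂lam := fun b => by
    rw [nextValue, ← integral_indicator hΔ.compl, hQd b,
      integral_withDensity_eq_integral_smul (hqm b)]
    rfl
  have hVi : ∀ y, ‖Δᶜ.indicator V y‖ ≤ C := fun y => by
    refine (norm_indicator_le_norm_self _ _).trans (hC y)
  have hVm : AEStronglyMeasurable (Δᶜ.indicator V) lam :=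
    (hV.indicator hΔ.compl).aestronglyMeasurable
  rw [hval, hval, ← integral_sub ((hqi b).mul_bdd hVm (Eventually.of_forall hVi))
    ((hqi a).mul_bdd hVm (Eventually.of_forall hVi)), ← integral_const_mul]
  have hint : Integrable (fun y => C * |(q (y, x, b) : ℝ) - (q (y, x, a) : ℝ)|) lam :=
    ((hqi b).sub (hqi a)).abs.const_mul C
  rw [← Real.norm_eq_abs]
  refine norm_integral_le_of_norm_le hint
    (Eventually.of_forall fun y => ?_)
  rw [← sub_mul, norm_mul, mul_comm]
  exact mul_le_mul_of_nonneg_right (hVi y) (norm_nonneg _)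

theorem isBoundedCaratheodory_nextValue (hA : AssumptionA G η ρ lam Δ) {V : X → ℝ}
    (hV : Measurable V) {C : ℝ} (hC : ∀ x, ‖V x‖ ≤ C) :
    IsBoundedCaratheodory (nextValue G Δ V) := by
  have hΔ := hA.measurableSet
  have hm : Measurable (nextValue G Δ V) := by
    have h1 : nextValue G Δ V = fun z => ∫ y, Δᶜ.indicator V y ∂(G.Q z) := by
      ext z; rw [integral_indicator hΔ.compl]; rfl
    rw [h1]
    exact (hV.indicator hΔ.compl).stronglyMeasurable.integral_kernel.measurable
  refine ⟨⟨fun a => hm.comp (measurable_id.prodMk measurable_const), fun x => ?_⟩, C,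
    abs_nextValue_le hC⟩
  refine continuous_iff_continuousAt.2 fun a => ?_
  obtain ⟨d, hd, hle⟩ := exists_dist_nextValue_le hA x a
  rw [ContinuousAt, tendsto_iff_norm_sub_tendsto_zero]
  refine squeeze_zero (fun _ => norm_nonneg _) (fun b => hle V C hV hC b) ?_
  simpa using hd.const_mul C

theorem integral_killedNext (hΔ : MeasurableSet Δ) (μ : Measure (X × (∀ j, A j)))
    [IsFiniteMeasure μ] {V : X → ℝ} (hV : Measurable V) {C : ℝ} (hC : ∀ x, ‖V x‖ ≤ C) :
    ∫ y, V y ∂(killedNext G Δ μ) = ∫ z, nextValue G Δ V z ∂μ := by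
  rw [killedNext, ← integral_indicator hΔ.compl, integral_comp_measure]
  · simp only [integral_indicator hΔ.compl]; rfl
  · exact Integrable.of_bound (hV.indicator hΔ.compl).aestronglyMeasurable C
      (Eventually.of_forall fun y => (norm_indicator_le_norm_self _ _).trans (hC y))

/-- The laws of the killed process depend continuously on the Markov strategy. -/
theorem tendsto_integral_killedLaw (hA : AssumptionA G η ρ lam Δ) {ν : Measure X}
    [IsProbabilityMeasure ν] (hν : ν ≪ lam) {κ : ℕ → CorrelatedMarkov G} {κ0 : CorrelatedMarkov G}
    (h : ∀ f : X × (∀ j, A j) → ℝ, IsBoundedCaratheodory f →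
      Tendsto (fun n => ∫ z, f z ∂(lam ⊗ₘ (κ n).kernel)) atTop
        (𝓝 (∫ z, f z ∂(lam ⊗ₘ κ0.kernel))))
    (t : ℕ) {F : ℕ → X → C(∀ j, A j, ℝ)} {F0 : X → C(∀ j, A j, ℝ)}
    (hF : ∀ n, StronglyMeasurable (F n)) (hF0 : StronglyMeasurable F0) {C : ℝ}
    (hC : ∀ n x, ‖F n x‖ ≤ C) (hC0 : ∀ x, ‖F0 x‖ ≤ C)
    (hlim : ∀ x, Tendsto (fun n => F n x) atTop (𝓝 (F0 x))) :
    Tendsto (fun n => ∫ z, F n z.1 z.2 ∂(killedLaw ν Δ (κ n).toStrategy t)) atTop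
      (𝓝 (∫ z, F0 z.1 z.2 ∂(killedLaw ν Δ κ0.toStrategy t))) := by
  have hlam := hA.isProbabilityMeasure
  have hΔ := hA.measurableSet
  -- Integrating out the last action and the last state lowers the time by one but makes the
  -- integrand depend on the strategy. Hence the claim is proved for varying `F n`.
  induction t generalizing F F0 C with
  | zero =>
    have h1 : ∀ κ : CorrelatedMarkov G, killedLaw ν Δ κ.toStrategy 0 =
        (ν.restrict Δᶜ) ⊗ₘ κ.kernel := fun κ => by
      rw [killedLaw_toStrategy hΔ, fst_killedLaw_zero hΔ]
    simp only [h1]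
    exact tendsto_integral_compProd h
      ((Measure.absolutelyContinuous_of_le Measure.restrict_le_self).trans hν) hF hF0 hC hC0 hlim
  | succ t ih =>
    let W : (X → C(∀ j, A j, ℝ)) → CorrelatedMarkov G → X → ℝ := fun F κ y =>
      ∫ b, F y b ∂(κ.kernel y)
    have hWm : ∀ F κ, StronglyMeasurable F → Measurable (W F κ) := fun F κ hF =>
      ((measurable_uncurry_continuousMap hF).stronglyMeasurable.integral_kernel_prod_right'
        (κ := κ.kernel)).measurable
    have hWC : ∀ F κ, (∀ x, ‖F x‖ ≤ C) → ∀ x, ‖W F κ x‖ ≤ C := fun F κ hF x => by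
      refine (norm_integral_le_of_norm_le_const (Eventually.of_forall fun b =>
        ((F x).norm_coe_le_norm b).trans (hF x))).trans ?_
      simp
    have hstep : ∀ (F : X → C(∀ j, A j, ℝ)) (κ : CorrelatedMarkov G), StronglyMeasurable F → (∀ x, ‖F x‖ ≤ C) →
        ∫ z, F z.1 z.2 ∂(killedLaw ν Δ κ.toStrategy (t + 1)) =
          ∫ z, nextValue G Δ (W F κ) z ∂(killedLaw ν Δ κ.toStrategy t) := fun F κ hF hFC => by
      rw [← integral_killedNext hΔ _ (hWm F κ hF) (hWC F κ hFC), killedLaw_toStrategy hΔ,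
        Measure.integral_compProd ((isBoundedCaratheodory_uncurry hF hFC).integrable _),
        fst_killedLaw_succ hΔ]
      rfl
    simp only [hstep _ _ (hF _) (hC _), hstep _ _ hF0 hC0]
    choose F' hF' hF'eq _ using fun n => (isBoundedCaratheodory_nextValue hA
      (hWm (F n) (κ n) (hF n)) (hWC (F n) (κ n) (hC n))).exists_continuousMap
    obtain ⟨F0', hF0', hF0'eq, _⟩ := (isBoundedCaratheodory_nextValue hA
      (hWm F0 κ0 hF0) (hWC F0 κ0 hC0)).exists_continuousMap
    have hbound : ∀ V : X → ℝ, (∀ x, ‖V x‖ ≤ C) → ∀ (x : X) (g : C(∀ j, A j, ℝ)),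
        (∀ b, g b = nextValue G Δ V (x, b)) → ‖g‖ ≤ C := fun V hV x g hg => by
      refine (ContinuousMap.norm_le _ ((norm_nonneg _).trans (hV x))).2 fun b => ?_
      rw [hg]
      exact abs_nextValue_le hV _
    have key := ih hF' hF0' (C := C)
      (fun n x => hbound _ (hWC (F n) (κ n) (hC n)) x _ (hF'eq n x))
      (fun x => hbound _ (hWC F0 κ0 hC0) x _ (hF0'eq x)) ?_
    · simpa only [hF'eq, hF0'eq] using key
    intro x
    -- Convergence is needed uniformly in the action. It follows from convergence at each fixed
    -- action `a` and the common modulus `d` near `a`.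
    rw [ContinuousMap.tendsto_iff_tendstoLocallyUniformly,
      tendstoLocallyUniformly_iff_forall_tendsto]
    intro a
    rw [tendsto_uniformity_iff_dist_tendsto_zero]
    obtain ⟨d, hd, hle⟩ := exists_dist_nextValue_le hA x a
    have hpt : Tendsto (fun n => nextValue G Δ (W (F n) (κ n)) (x, a)) atTop
        (𝓝 (nextValue G Δ (W F0 κ0) (x, a))) := by
      have hac : (G.Q (x, a)).restrict Δᶜ ≪ lam := by
        refine (Measure.absolutelyContinuous_of_le Measure.restrict_le_self).trans ?_
        obtain ⟨q, -, hQ, -⟩ := hA.density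
        refine Measure.AbsolutelyContinuous.mk fun s hs h0 => ?_
        rw [hQ x a s hs, Measure.restrict_zero_set h0, lintegral_zero_measure]
      have hconv := tendsto_integral_compProd h hac hF hF0 hC hC0 hlim
      have heq : ∀ (F : X → C(∀ j, A j, ℝ)) (κ : CorrelatedMarkov G), StronglyMeasurable F → (∀ x, ‖F x‖ ≤ C) →
          ∫ z, F z.1 z.2 ∂((G.Q (x, a)).restrict Δᶜ ⊗ₘ κ.kernel) =
            nextValue G Δ (W F κ) (x, a) := fun F κ hF hFC => by
        rw [Measure.integral_compProd ((isBoundedCaratheodory_uncurry hF hFC).integrable _)]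
        rfl
      simpa only [heq _ _ (hF _) (hC _), heq _ _ hF0 hC0] using hconv
    have hlim2 : Tendsto (fun y : ℕ × (∀ j, A j) => 2 * C * d y.2 +
        |nextValue G Δ (W (F y.1) (κ y.1)) (x, a) - nextValue G Δ (W F0 κ0) (x, a)|)
        (atTop ×ˢ 𝓝 a) (𝓝 0) := by
      have h1 := (hd.comp (tendsto_snd (f := (atTop : Filter ℕ)))).const_mul (2 * C)
      have h2 := (tendsto_iff_norm_sub_tendsto_zero.1 hpt).comp
        (tendsto_fst (g := 𝓝 a))
      simpa using h1.add h2
    refine squeeze_zero (fun _ => dist_nonneg) (fun y => ?_) hlim2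
    rw [hF0'eq, hF'eq, Real.dist_eq]
    have h1 := hle (W F0 κ0) C (hWm F0 κ0 hF0) (hWC F0 κ0 hC0) y.2
    have h2 := hle (W (F y.1) (κ y.1)) C (hWm _ _ (hF _)) (hWC _ _ (hC _)) y.2
    set u := nextValue G Δ (W F0 κ0) (x, y.2)
    set v := nextValue G Δ (W (F y.1) (κ y.1)) (x, y.2)
    set u' := nextValue G Δ (W F0 κ0) (x, a)
    set v' := nextValue G Δ (W (F y.1) (κ y.1)) (x, a)
    have h3 : u - v = (u - u') - (v - v') - (v' - u') := by ring
    rw [h3]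
    refine (abs_sub _ _).trans ?_
    have h4 := abs_sub (u - u') (v - v')
    linarith

end Transition

/-! ### The space of Markov strategies with the Young topology. -/

section Young

variable {X : Type*} [MeasurableSpace X] {N : ℕ} {A : Fin N → Type*}
  [∀ i, MetricSpace (A i)] [∀ i, CompactSpace (A i)] [∀ i, SecondCountableTopology (A i)]
  [∀ i, MeasurableSpace (A i)] [∀ i, BorelSpace (A i)] {p : ℕ} {G : GameModel X A p}
  {η lam : Measure X} {Δ : Set X} {ρ : Fin N → Fin p → ℝ}

/-- The Young measure of a Markov strategy. -/
noncomputable def youngMeasure (lam : Measure X) [IsFiniteMeasure lam] (κ : CorrelatedMarkov G) :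
    FiniteMeasure (X × (∀ j, A j)) :=
  ⟨lam ⊗ₘ κ.kernel, inferInstance⟩

variable (G) in
/-- The topology of Markov strategies induced by their Young measures. -/
noncomputable abbrev youngTopology (lam : Measure X) [IsFiniteMeasure lam] :
    TopologicalSpace (CorrelatedMarkov G) :=
  TopologicalSpace.induced (youngMeasure lam) (wsTopology X (∀ j, A j))

theorem tendsto_youngTopology_iff [IsFiniteMeasure lam] {J : Type*} {l : Filter J}
    {κ : J → CorrelatedMarkov G} {κ0 : CorrelatedMarkov G} :
    Tendsto κ l (@nhds _ (youngTopology G lam) κ0) ↔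
      ∀ f : X × (∀ j, A j) → ℝ, IsBoundedCaratheodory f →
        Tendsto (fun n => ∫ z, f z ∂(lam ⊗ₘ (κ n).kernel)) l
          (𝓝 (∫ z, f z ∂(lam ⊗ₘ κ0.kernel))) := by
  rw [@nhds_induced _ _ (wsTopology X (∀ j, A j)) (youngMeasure lam) κ0, tendsto_comap_iff,
    tendsto_wsTopology_iff]
  rfl

theorem isBoundedCaratheodory_fst {S : X → ℝ} (hS : Measurable S) {C : ℝ} (hC : ∀ x, ‖S x‖ ≤ C)
    (B : Type*) [TopologicalSpace B] : IsBoundedCaratheodory fun z : X × B => S z.1 :=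
  ⟨⟨fun _ => hS, fun x => continuous_const (y := S x)⟩, C, fun z => hC z.1⟩

theorem norm_indicator_one_le (s : Set X) (x : X) : ‖s.indicator (1 : X → ℝ) x‖ ≤ 1 := by
  refine (norm_indicator_le_norm_self _ _).trans ?_
  simp

theorem integral_indicator_fst {B : Type*} [MeasurableSpace B] (μ : Measure (X × B)) {s : Set X}
    (hs : MeasurableSet s) : ∫ z, s.indicator (1 : X → ℝ) z.1 ∂μ = μ.fst.real s := by
  rw [← integral_indicator_one hs, Measure.fst, integral_map measurable_fst.aemeasurable
    (measurable_one.indicator hs).aestronglyMeasurable]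

theorem compl_graphSet_of_tendsto (hA : AssumptionA G η ρ lam Δ) {J : Type*} {l : Filter J} [l.NeBot]
    {μ : J → Measure (X × (∀ j, A j))} [∀ j, IsFiniteMeasure (μ j)]
    {μ0 : Measure (X × (∀ j, A j))} [IsFiniteMeasure μ0]
    (h : ∀ f : X × (∀ j, A j) → ℝ, IsBoundedCaratheodory f →
      Tendsto (fun j => ∫ z, f z ∂(μ j)) l (𝓝 (∫ z, f z ∂μ0)))
    (hμ : ∀ j, μ j (graphSet G)ᶜ = 0) : μ0 (graphSet G)ᶜ = 0 := by
  rw [measure_compl_graphSet_eq_zero_iff hA]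
  intro i
  have h1 := h _ (isBoundedCaratheodory_infDist hA i)
  simp only [(measure_compl_graphSet_eq_zero_iff hA _).1 (hμ _) i] at h1
  exact tendsto_nhds_unique h1 tendsto_const_nhds

/-- All Young measures have state marginal `lam`, so limits along ultrafilters exist. The limit
keeps this marginal and stays on the graph, hence disintegrates into a strategy. -/
theorem compactSpace_youngTopology [Nonempty (∀ j, A j)] (hA : AssumptionA G η ρ lam Δ)
    [IsFiniteMeasure lam] : @CompactSpace (CorrelatedMarkov G) (youngTopology G lam) := by
  have hX := hA.countablyGenerated
  let T : TopologicalSpace (CorrelatedMarkov G) := youngTopology G lam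
  refine ⟨isCompact_iff_ultrafilter_le_nhds.2 fun U _ => ?_⟩
  -- Some strategy is needed for the disintegration; the ultrafilter provides one.
  obtain ⟨κ₁⟩ : Nonempty (CorrelatedMarkov G) := U.nonempty_of_mem univ_mem |>.to_type
  obtain ⟨μ0, hfin, hμ0⟩ := exists_tendsto_of_marginal_le U
    (fun κ : CorrelatedMarkov G => lam ⊗ₘ κ.kernel) lam (fun S hS ⟨C, hC⟩ hS0 ε hε =>
      Eventually.of_forall fun κ => by
        have hi : Integrable (fun z : X × (∀ j, A j) => S z.1) (lam ⊗ₘ κ.kernel) :=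
          Integrable.of_bound (hS.comp measurable_fst).aestronglyMeasurable C
            (Eventually.of_forall fun z => by rw [Real.norm_of_nonneg (hS0 _)]; exact hC _)
        rw [Measure.integral_compProd hi]
        simp [hε.le])
  have hg : ∀ κ : CorrelatedMarkov G, (lam ⊗ₘ κ.kernel) (graphSet G)ᶜ = 0 := fun κ => by
    have hS := measurableSet_graphSet hA
    rw [Measure.compProd_apply hS.compl, lintegral_eq_zero_iff
      (Kernel.measurable_kernel_prodMk_left hS.compl)]
    exact Eventually.of_forall fun x =>
      (prob_compl_eq_zero_iff (measurable_prodMk_left (x := x) hS)).2 (κ.supported x)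
  have hfst : μ0.fst = lam := by
    ext s hs
    rw [← measureReal_eq_measureReal_iff, ← integral_indicator_fst μ0 hs]
    have h1 := hμ0 _ (isBoundedCaratheodory_fst (measurable_one.indicator hs)
      (norm_indicator_one_le s) (∀ j, A j))
    simp only [integral_indicator_fst _ hs, Measure.fst_compProd] at h1
    rw [integral_indicator_fst _ hs]
    exact tendsto_nhds_unique h1 tendsto_const_nhds
  obtain ⟨κ0, hκ0⟩ := exists_markov_disintegration hA κ₁.toStrategy μ0
    (compl_graphSet_of_tendsto hA hμ0 hg)
  refine ⟨κ0, Set.mem_univ _, ?_⟩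
  rw [← tendsto_id', tendsto_youngTopology_iff]
  intro f hf
  rw [hfst] at hκ0
  rw [← hκ0]
  exact hμ0 f hf

/-- Continuity of the killed laws rests on dominated convergence along sequences, so sequences must
determine the topology. Strategies equal `lam`-almost everywhere are not separated; thus
metrizability is used only on the range of `youngMeasure`. -/
theorem firstCountableTopology_youngTopology [Nonempty (∀ j, A j)] (hA : AssumptionA G η ρ lam Δ)
    [IsFiniteMeasure lam] :
    @FirstCountableTopology (CorrelatedMarkov G) (youngTopology G lam) := by
  have hX := hA.countablyGenerated
  let W : TopologicalSpace (FiniteMeasure (X × (∀ j, A j))) := wsTopology X (∀ j, A j)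
  let T : TopologicalSpace (CorrelatedMarkov G) := youngTopology G lam
  have hT : CompactSpace (CorrelatedMarkov G) := compactSpace_youngTopology hA
  let s : Set (FiniteMeasure (X × (∀ j, A j))) := Set.range (youngMeasure (G := G) lam)
  have hs : CompactSpace s := isCompact_iff_compactSpace.1
    (isCompact_range (continuous_induced_dom (f := youngMeasure (G := G) lam)))
  have hm : TopologicalSpace.MetrizableSpace s := (isCompactMetrizable_of_compactSpace hs).2
  have h1 : T = TopologicalSpace.induced (Set.rangeFactorization (youngMeasure (G := G) lam))
      inferInstance := by
    rw [instTopologicalSpaceSubtype, induced_compose]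
    rfl
  change @FirstCountableTopology _ T
  exact h1 ▸ TopologicalSpace.firstCountableTopology_induced _ _ _

theorem continuous_integral_killedLaw [Nonempty (∀ j, A j)] (hA : AssumptionA G η ρ lam Δ)
    [IsFiniteMeasure lam] [IsProbabilityMeasure η] (t : ℕ) {f : X × (∀ j, A j) → ℝ}
    (hf : IsBoundedCaratheodory f) :
    Continuous[youngTopology G lam, inferInstance] fun κ : CorrelatedMarkov G =>
      ∫ z, f z ∂(killedLaw η Δ κ.toStrategy t) := by
  let T : TopologicalSpace (CorrelatedMarkov G) := youngTopology G lam
  have hT : FirstCountableTopology (CorrelatedMarkov G) := firstCountableTopology_youngTopology hA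
  obtain ⟨F, hF, hFf, C, hC⟩ := hf.exists_continuousMap
  refine SeqContinuous.continuous fun κ κ0 hκ => ?_
  have h := tendsto_integral_killedLaw hA hA.absolutelyContinuous
    (tendsto_youngTopology_iff.1 hκ) t (F := fun _ => F) (F0 := F) (fun _ => hF) hF
    (fun _ => hC) hC (fun _ => tendsto_const_nhds)
  simp only [hFf] at h
  exact h

end Young

/-! ### Tails of the occupation measures. -/

section Tail

variable {X : Type*} [MeasurableSpace X] {N : ℕ} {A : Fin N → Type*}
  [∀ i, MeasurableSpace (A i)] {p : ℕ} {G : GameModel X A p}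

/-- The part of the occupation measure after time `n`. -/
noncomputable def tailMeasure (η : Measure X) (Δ : Set X) (π : CorrelatedStrategy G) (n : ℕ) :
    Measure (X × (∀ j, A j)) :=
  Measure.sum fun t => killedLaw η Δ π (n + t)

theorem occupationMeasure_eq_sum_add_tail (η : Measure X) (Δ : Set X) (π : CorrelatedStrategy G)
    (n : ℕ) : occupationMeasure η Δ π =
      ∑ t ∈ Finset.range n, killedLaw η Δ π t + tailMeasure η Δ π n := by
  ext s hs
  have h := Summable.sum_add_tsum_nat_add' (M := ℝ≥0∞) (f := fun t => killedLaw η Δ π t s) (k := n)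
    ENNReal.summable
  rw [occupationMeasure_eq_sum, Measure.sum_apply _ hs, Measure.add_apply, Measure.finsetSum_apply,
    tailMeasure, Measure.sum_apply _ hs, ← h]
  simp only [add_comm]

theorem tailMeasure_univ (η : Measure X) (Δ : Set X) (π : CorrelatedStrategy G) (n : ℕ) :
    tailMeasure η Δ π n Set.univ =
      ∑' t : ℕ, π.law η {ω | ((n + t : ℕ) : ℕ∞) < hittingTime Δ ω} := by
  rw [tailMeasure, Measure.sum_apply _ MeasurableSet.univ]
  refine tsum_congr fun t => ?_
  rw [killedLaw, Measure.map_apply (measurable_pi_apply _) MeasurableSet.univ, Set.preimage_univ,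
    Measure.restrict_apply_univ]

theorem tailMeasure_zero (η : Measure X) (Δ : Set X) (π : CorrelatedStrategy G) :
    tailMeasure η Δ π 0 = occupationMeasure η Δ π := by
  rw [occupationMeasure_eq_sum_add_tail η Δ π 0]; simp

theorem tailMeasure_succ_le (η : Measure X) (Δ : Set X) (π : CorrelatedStrategy G) (n : ℕ) :
    tailMeasure η Δ π (n + 1) ≤ tailMeasure η Δ π n := by
  refine Measure.le_iff.2 fun s hs => ?_
  rw [tailMeasure, tailMeasure, Measure.sum_apply _ hs, Measure.sum_apply _ hs,
    tsum_eq_zero_add' (f := fun t => killedLaw η Δ π (n + t) s) ENNReal.summable]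
  refine le_add_left (le_of_eq (tsum_congr fun t => ?_))
  rw [Nat.add_assoc, Nat.add_comm 1 t]

theorem antitone_tailMeasure (η : Measure X) (Δ : Set X) (π : CorrelatedStrategy G) :
    Antitone (tailMeasure η Δ π) :=
  antitone_nat_of_succ_le (tailMeasure_succ_le η Δ π)

theorem tailMeasure_le (η : Measure X) (Δ : Set X) (π : CorrelatedStrategy G) (n : ℕ) :
    tailMeasure η Δ π n ≤ occupationMeasure η Δ π := by
  rw [← tailMeasure_zero]
  exact antitone_tailMeasure η Δ π (Nat.zero_le n)

theorem tendsto_tailMeasure_univ {η : Measure X} {Δ : Set X} (hΔ : MeasurableSet Δ)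
    (h : IsAbsorbing G η Δ) (π : CorrelatedStrategy G) :
    Tendsto (fun n => tailMeasure η Δ π n Set.univ) atTop (𝓝 0) := by
  have hfin := isFiniteMeasure_occupationMeasure hΔ h π
  have h1 : ∑' t, killedLaw η Δ π t Set.univ ≠ ∞ := by
    rw [← Measure.sum_apply _ MeasurableSet.univ, ← occupationMeasure_eq_sum]
    exact measure_ne_top _ _
  have h2 := ENNReal.tendsto_sum_nat_add _ h1
  refine h2.congr fun n => ?_
  rw [tailMeasure, Measure.sum_apply _ MeasurableSet.univ]
  simp only [add_comm]

end Tail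

/-! ### Convexity and the equivalences. -/

section Equivalence

variable {X : Type*} [MeasurableSpace X] {N : ℕ} {A : Fin N → Type*}
  [∀ i, MetricSpace (A i)] [∀ i, CompactSpace (A i)] [∀ i, SecondCountableTopology (A i)]
  [∀ i, MeasurableSpace (A i)] [∀ i, BorelSpace (A i)] {p : ℕ} {G : GameModel X A p}
  {η lam : Measure X} [IsProbabilityMeasure η] {Δ : Set X} {ρ : Fin N → Fin p → ℝ}

theorem isFiniteMeasure_tailMeasure (hA : AssumptionA G η ρ lam Δ) (π : CorrelatedStrategy G)
    (n : ℕ) : IsFiniteMeasure (tailMeasure η Δ π n) := by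
  have := isFiniteMeasure_occupationMeasure hA.measurableSet hA.absorbing π
  exact isFiniteMeasure_of_le _ (tailMeasure_le η Δ π n)

theorem integral_occupationMeasure_eq (hA : AssumptionA G η ρ lam Δ) (π : CorrelatedStrategy G)
    (n : ℕ) {f : X × (∀ j, A j) → ℝ} (hf : IsBoundedCaratheodory f) :
    ∫ z, f z ∂(occupationMeasure η Δ π) =
      ∑ t ∈ Finset.range n, ∫ z, f z ∂(killedLaw η Δ π t) + ∫ z, f z ∂(tailMeasure η Δ π n) := by
  have := isFiniteMeasure_tailMeasure hA π n
  rw [occupationMeasure_eq_sum_add_tail η Δ π n, integral_add_measure (hf.integrable _)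
    (hf.integrable _), integral_finsetSum_measure fun t _ => hf.integrable _]

theorem mem_occupationSet_iff [Nonempty (∀ j, A j)] (hA : AssumptionA G η ρ lam Δ)
    (π : CorrelatedStrategy G) (μ : FiniteMeasure (X × (∀ j, A j))) :
    μ ∈ occupationSet G η Δ ↔ IsCharacteristic G η Δ (μ : Measure (X × (∀ j, A j))) := by
  constructor
  · rintro ⟨π, hπ⟩
    rw [hπ]
    exact isCharacteristic_occupationMeasure hA π
  · intro h
    obtain ⟨κ, hκ⟩ := h.exists_markov hA π
    exact ⟨κ.toStrategy, hκ⟩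

theorem convex_occupationSet [Nonempty (∀ j, A j)] (hA : AssumptionA G η ρ lam Δ) :
    Convex ℝ≥0 (occupationSet G η Δ) := by
  intro μ hμ ν hν a b _ _ hab
  obtain ⟨π, -⟩ := id hμ
  rw [mem_occupationSet_iff hA π] at hμ hν ⊢
  have hab' : (a : ℝ≥0∞) + b = 1 := by exact_mod_cast hab
  have hcoe : ((a • μ + b • ν : FiniteMeasure (X × (∀ j, A j))) : Measure (X × (∀ j, A j))) =
      (a : ℝ≥0∞) • (μ : Measure (X × (∀ j, A j))) + (b : ℝ≥0∞) • (ν : Measure (X × (∀ j, A j))) :=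
    rfl
  rw [hcoe]
  refine ⟨?_, ?_⟩
  · rw [Measure.fst_add, killedNext_add, killedNext_smul, killedNext_smul, Measure.fst,
      Measure.map_smul, Measure.fst, Measure.map_smul]
    change (a : ℝ≥0∞) • (μ : Measure (X × (∀ j, A j))).fst +
      (b : ℝ≥0∞) • (ν : Measure (X × (∀ j, A j))).fst = _
    rw [hμ.fst_eq, hν.fst_eq, smul_add, smul_add, add_add_add_comm, ← add_smul, hab', one_smul]
  · rw [Measure.add_apply, Measure.smul_apply, Measure.smul_apply, hμ.graph, hν.graph]
    simp

theorem convex_marginalOccupationSet [Nonempty (∀ j, A j)] (hA : AssumptionA G η ρ lam Δ)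
    (i : Fin N) : Convex ℝ≥0 (marginalOccupationSet G η Δ i) := by
  rintro _ ⟨μ, hμ, rfl⟩ _ ⟨ν, hν, rfl⟩ a b ha hb hab
  have hm : Measurable fun z : X × (∀ j, A j) => (z.1, z.2 i) := by fun_prop
  refine ⟨_, convex_occupationSet hA hμ hν ha hb hab, ?_⟩
  change (a • μ + b • ν).map _ = _
  rw [FiniteMeasure.map_add hm, FiniteMeasure.map_smul, FiniteMeasure.map_smul]

/-- Uniformly absorbing games have a compact metrizable set of occupation measures. -/
theorem IsUniformlyAbsorbing.isCompactMetrizable [Nonempty (∀ j, A j)]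
    (hA : AssumptionA G η ρ lam Δ) (h : IsUniformlyAbsorbing G η Δ) :
    IsCompactMetrizable (wsTopology X (∀ j, A j)) (occupationSet G η Δ) := by
  have hX := hA.countablyGenerated
  have hlam := hA.isProbabilityMeasure
  have hΔ := hA.measurableSet
  refine isCompactMetrizable_of_compactSpace ?_
  let W : TopologicalSpace (FiniteMeasure (X × (∀ j, A j))) := wsTopology X (∀ j, A j)
  let T : TopologicalSpace (CorrelatedMarkov G) := youngTopology G lam
  have hT : CompactSpace (CorrelatedMarkov G) := compactSpace_youngTopology hA
  have hfin := fun κ : CorrelatedMarkov G =>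
    isFiniteMeasure_occupationMeasure hΔ hA.absorbing κ.toStrategy
  let Φ : CorrelatedMarkov G → FiniteMeasure (X × (∀ j, A j)) := fun κ =>
    ⟨occupationMeasure η Δ κ.toStrategy, hfin κ⟩
  have hrange : occupationSet G η Δ = Set.range Φ := by
    ext μ
    constructor
    · intro hμ
      obtain ⟨π, -⟩ := id hμ
      obtain ⟨κ, hκ⟩ := ((mem_occupationSet_iff hA π μ).1 hμ).exists_markov hA π
      exact ⟨κ, Subtype.ext hκ.symm⟩
    · rintro ⟨κ, rfl⟩
      exact ⟨κ.toStrategy, rfl⟩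
  have hΦ : Continuous Φ := by
    refine continuous_iInf_rng.2 fun f => continuous_induced_rng.2 ?_
    obtain ⟨f, hf⟩ := f
    obtain ⟨C, hC⟩ := hf.2
    change Continuous fun κ : CorrelatedMarkov G => ∫ z, f z ∂(occupationMeasure η Δ κ.toStrategy)
    -- The remainder of the series is at most a bound of `f` times the tail mass, which is small
    -- uniformly in `κ`.
    refine TendstoUniformly.continuous (p := atTop)
      (F := fun (n : ℕ) (κ : CorrelatedMarkov G) =>
        ∑ t ∈ Finset.range n, ∫ z, f z ∂(killedLaw η Δ κ.toStrategy t)) ?_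
      (Frequently.of_forall fun n => continuous_finsetSum _ fun t _ =>
        continuous_integral_killedLaw hA t hf)
    rw [Metric.tendstoUniformly_iff]
    intro ε hε
    -- Adding one keeps the divisor positive when `C = 0`.
    have hC1 : 0 < |C| + 1 := by positivity
    have hδ : 0 < ENNReal.ofReal (ε / (2 * (|C| + 1))) := ENNReal.ofReal_pos.2 (by positivity)
    filter_upwards [ENNReal.tendsto_nhds_zero.1 h.uniform_tail _ hδ] with n hn κ
    have h1 : tailMeasure η Δ κ.toStrategy n Set.univ ≤ ENNReal.ofReal (ε / (2 * (|C| + 1))) := by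
      rw [tailMeasure_univ]
      exact (le_iSup (fun κ : CorrelatedMarkov G => ∑' t : ℕ, κ.toStrategy.law η
        {ω | ((n + t : ℕ) : ℕ∞) < hittingTime Δ ω}) κ).trans hn
    have h2 : (tailMeasure η Δ κ.toStrategy n).real Set.univ ≤ ε / (2 * (|C| + 1)) :=
      ENNReal.toReal_le_of_le_ofReal (by positivity) h1
    rw [integral_occupationMeasure_eq hA _ n hf, Real.dist_eq, add_sub_cancel_left]
    have := isFiniteMeasure_tailMeasure hA κ.toStrategy n
    have h3 : |∫ z, f z ∂(tailMeasure η Δ κ.toStrategy n)| ≤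
        (|C| + 1) * (tailMeasure η Δ κ.toStrategy n).real Set.univ :=
      norm_integral_le_of_norm_le_const (Eventually.of_forall fun z =>
        (hC z).trans ((le_abs_self C).trans (by linarith)))
    refine h3.trans_lt ((mul_le_mul_of_nonneg_left h2 hC1.le).trans_lt ?_)
    have : (|C| + 1) * (ε / (2 * (|C| + 1))) = ε / 2 := by field_simp
    linarith
  have hcomp : IsCompact (occupationSet G η Δ) := by
    rw [hrange]; exact isCompact_range hΦ
  exact isCompact_iff_compactSpace.1 hcomp

theorem isBoundedCaratheodory_comp_marginal {i : Fin N} {f : X × A i → ℝ}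
    (hf : IsBoundedCaratheodory f) :
    IsBoundedCaratheodory fun z : X × (∀ j, A j) => f (z.1, z.2 i) := by
  obtain ⟨C, hC⟩ := hf.2
  exact ⟨⟨fun a => hf.1.1 (a i), fun x =>
    (hf.1.2 x).comp (continuous_apply (A := fun j => A j) i)⟩, C, fun z => hC _⟩

theorem integral_map_marginal (i : Fin N) (μ : FiniteMeasure (X × (∀ j, A j))) {f : X × A i → ℝ}
    (hf : Measurable f) :
    ∫ z, f z ∂((μ.map fun z => (z.1, z.2 i) : FiniteMeasure (X × A i)) : Measure (X × A i)) =
      ∫ z, f (z.1, z.2 i) ∂(μ : Measure (X × (∀ j, A j))) := by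
  rw [FiniteMeasure.toMeasure_map, integral_map (by fun_prop) hf.aestronglyMeasurable]

theorem IsCompactMetrizable.marginal (hA : AssumptionA G η ρ lam Δ)
    (h : IsCompactMetrizable (wsTopology X (∀ j, A j)) (occupationSet G η Δ)) (i : Fin N) :
    IsCompactMetrizable (wsTopology X (A i)) (marginalOccupationSet G η Δ i) := by
  have hX := hA.countablyGenerated
  refine isCompactMetrizable_of_compactSpace ?_
  let W : TopologicalSpace (FiniteMeasure (X × (∀ j, A j))) := wsTopology X (∀ j, A j)
  let W' : TopologicalSpace (FiniteMeasure (X × A i)) := wsTopology X (A i)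
  have hcont : Continuous fun μ : FiniteMeasure (X × (∀ j, A j)) =>
      (μ.map fun z => (z.1, z.2 i) : FiniteMeasure (X × A i)) := by
    refine continuous_iInf_rng.2 fun f => continuous_induced_rng.2 ?_
    have h1 := continuous_integral_wsTopology (isBoundedCaratheodory_comp_marginal f.2)
    have h2 := fun μ => integral_map_marginal i μ f.2.measurable
    simp only [← h2] at h1
    exact h1
  exact isCompact_iff_compactSpace.1 ((isCompact_iff_compactSpace.2 h.1).image hcont)

/-- Tested on a measurable set of states, both sides of the equation are, up to a constant,
integrals of bounded Carathéodory functions: an indicator in the state and the corresponding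
`nextValue`. -/
theorem isCharacteristic_of_tendsto (hA : AssumptionA G η ρ lam Δ) {J : Type*} {l : Filter J}
    [l.NeBot] {μ : J → Measure (X × (∀ j, A j))} [∀ j, IsFiniteMeasure (μ j)]
    {μ0 : Measure (X × (∀ j, A j))} [IsFiniteMeasure μ0]
    (h : ∀ f : X × (∀ j, A j) → ℝ, IsBoundedCaratheodory f →
      Tendsto (fun j => ∫ z, f z ∂(μ j)) l (𝓝 (∫ z, f z ∂μ0)))
    (hμ : ∀ j, IsCharacteristic G η Δ (μ j)) : IsCharacteristic G η Δ μ0 := by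
  have hΔ := hA.measurableSet
  refine ⟨?_, compl_graphSet_of_tendsto hA h fun j => (hμ j).graph⟩
  ext s hs
  rw [← measureReal_eq_measureReal_iff]
  have hs1 : Measurable (s.indicator (1 : X → ℝ)) := measurable_one.indicator hs
  have hk : ∀ ν : Measure (X × (∀ j, A j)), IsFiniteMeasure ν →
      (η.restrict Δᶜ + killedNext G Δ ν).real s =
        (η.restrict Δᶜ).real s + ∫ z, nextValue G Δ (s.indicator 1) z ∂ν := fun ν _ => by
    rw [measureReal_add_apply, ← integral_indicator_one (μ := killedNext G Δ ν) hs,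
      ← integral_killedNext hΔ ν hs1 (norm_indicator_one_le s)]
  have h1 := h _ (isBoundedCaratheodory_fst hs1 (norm_indicator_one_le s) (∀ j, A j))
  have h2 := (h _ (isBoundedCaratheodory_nextValue hA hs1 (norm_indicator_one_le s))).const_add
    ((η.restrict Δᶜ).real s)
  simp only [integral_indicator_fst _ hs] at h1
  simp only [← hk _ inferInstance, ← (hμ _).fst_eq] at h2
  exact tendsto_nhds_unique h1 h2

/-- If the marginals of the occupation measures on the state-action pairs of one player form a compact
set, then the game is uniformly absorbing. -/
theorem IsCompactMetrizable.isUniformlyAbsorbing [Nonempty (∀ j, A j)]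
    (hA : AssumptionA G η ρ lam Δ) (i : Fin N)
    (h : IsCompactMetrizable (wsTopology X (A i)) (marginalOccupationSet G η Δ i)) :
    IsUniformlyAbsorbing G η Δ := by
  refine ⟨hA.absorbing, ?_⟩
  have hX := hA.countablyGenerated
  have hlam := hA.isProbabilityMeasure
  have hΔ := hA.measurableSet
  simp only [← tailMeasure_univ]
  rw [ENNReal.tendsto_atTop_zero]
  by_contra! hcon
  obtain ⟨ε, hε, hcon⟩ := hcon
  -- The failure occurs at some `m ≥ n`; tails decrease in time, so it also holds at `n`.
  have hex : ∀ n, ∃ κ : CorrelatedMarkov G, ε < tailMeasure η Δ κ.toStrategy n Set.univ := fun n => by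
    obtain ⟨m, hm, hlt⟩ := hcon n
    obtain ⟨κ, hκ⟩ := lt_iSup_iff.1 hlt
    exact ⟨κ, hκ.trans_le (antitone_tailMeasure η Δ κ.toStrategy hm Set.univ)⟩
  choose κ hκ using hex
  have hfinO := fun π : CorrelatedStrategy G =>
    isFiniteMeasure_occupationMeasure hΔ hA.absorbing π
  have hfinT := isFiniteMeasure_tailMeasure (G := G) hA
  let U : Ultrafilter ℕ := Filter.hyperfilter ℕ
  have hU : (U : Filter ℕ) ≤ atTop := Nat.hyperfilter_le_atTop
  let T : TopologicalSpace (CorrelatedMarkov G) := youngTopology G lam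
  have hT : CompactSpace (CorrelatedMarkov G) := compactSpace_youngTopology hA
  -- a limit strategy
  obtain ⟨κ0, -, hκ0⟩ := isCompact_iff_ultrafilter_le_nhds.1
    (isCompact_univ (X := CorrelatedMarkov G)) (U.map κ) (by simp)
  have hkilled : ∀ (t : ℕ) (f : X × (∀ j, A j) → ℝ), IsBoundedCaratheodory f →
      Tendsto (fun n => ∫ z, f z ∂(killedLaw η Δ (κ n).toStrategy t)) U
        (𝓝 (∫ z, f z ∂(killedLaw η Δ κ0.toStrategy t))) := fun t f hf =>
    ((continuous_integral_killedLaw hA t hf).tendsto κ0).comp hκ0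
  -- a limit of the state marginals
  let W' : TopologicalSpace (FiniteMeasure (X × A i)) := wsTopology X (A i)
  let O : ℕ → FiniteMeasure (X × (∀ j, A j)) := fun n =>
    ⟨occupationMeasure η Δ (κ n).toStrategy, hfinO _⟩
  obtain ⟨θ, -, hθ⟩ := isCompact_iff_ultrafilter_le_nhds.1 (isCompact_iff_compactSpace.2 h.1)
    (U.map fun n => ((O n).map fun z => (z.1, z.2 i) : FiniteMeasure (X × A i))) (by
      rw [Ultrafilter.coe_map]
      exact tendsto_principal.2 (Eventually.of_forall fun n =>
        ⟨O n, ⟨(κ n).toStrategy, rfl⟩, rfl⟩))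
  have hθ' := tendsto_wsTopology_iff.1 hθ
  let ν : Measure X := (θ : Measure (X × A i)).fst
  -- Tails lie below the occupation measures, whose state marginals converge to `ν`; the bound is
  -- therefore uniform in the starting time `k`.
  have hdom : ∀ S : X → ℝ, Measurable S → (∃ C, ∀ x, S x ≤ C) → (∀ x, 0 ≤ S x) → ∀ ε > 0,
      ∀ᶠ n in (U : Filter ℕ), ∀ k, ∫ z, S z.1 ∂(tailMeasure η Δ (κ n).toStrategy k) ≤
        ∫ x, S x ∂ν + ε := by
    rintro S hS ⟨C, hC⟩ hS0 δ hδ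
    have hSC : ∀ x, ‖S x‖ ≤ C := fun x => by rw [Real.norm_of_nonneg (hS0 x)]; exact hC x
    have h1 := hθ' _ (isBoundedCaratheodory_fst hS hSC (A i))
    have h2 : ∫ z, S z.1 ∂(θ : Measure (X × A i)) = ∫ x, S x ∂ν :=
      (integral_map measurable_fst.aemeasurable hS.aestronglyMeasurable).symm
    rw [h2] at h1
    filter_upwards [(tendsto_order.1 h1).2 _ (lt_add_of_pos_right _ hδ)] with n hn k
    refine le_trans ?_ hn.le
    have h3 := integral_map_marginal i (O n) (f := fun z => S z.1) (hS.comp measurable_fst)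
    rw [h3]
    exact integral_mono_measure (tailMeasure_le η Δ _ k) (Eventually.of_forall fun z => hS0 _)
      ((isBoundedCaratheodory_fst hS hSC (∀ j, A j)).integrable _)
  have hlim : ∀ k, ∃ τ : Measure (X × (∀ j, A j)), IsFiniteMeasure τ ∧
      ∀ f : X × (∀ j, A j) → ℝ, IsBoundedCaratheodory f →
        Tendsto (fun n => ∫ z, f z ∂(tailMeasure η Δ (κ n).toStrategy k)) U
          (𝓝 (∫ z, f z ∂τ)) := fun k =>
    exists_tendsto_of_marginal_le U (fun n => tailMeasure η Δ (κ n).toStrategy k) ν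
      fun S hS hC hS0 δ hδ => (hdom S hS hC hS0 δ hδ).mono fun n hn => hn k
  choose τ hτfin hτ using hlim
  have hτ0 : ∀ f : X × (∀ j, A j) → ℝ, IsBoundedCaratheodory f →
      Tendsto (fun n => ∫ z, f z ∂(occupationMeasure η Δ (κ n).toStrategy)) U
        (𝓝 (∫ z, f z ∂(τ 0))) := by
    simpa only [tailMeasure_zero] using hτ 0
  -- The first `k` terms converge to those of `κ0`, so any mass escaping to infinity in time is
  -- retained in `τ k`.
  have hsum : ∀ k, τ 0 = ∑ t ∈ Finset.range k, killedLaw η Δ κ0.toStrategy t + τ k := fun k => by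
    refine eq_of_forall_integral_caratheodory_eq fun f hf => ?_
    rw [integral_add_measure (hf.integrable _) (hf.integrable _),
      integral_finsetSum_measure fun t _ => hf.integrable _]
    refine tendsto_nhds_unique (hτ0 f hf) ?_
    simp only [integral_occupationMeasure_eq hA _ k hf]
    exact (tendsto_finsetSum _ fun t _ => hkilled t f hf).add (hτ k f hf)
  have hle : occupationMeasure η Δ κ0.toStrategy ≤ τ 0 :=
    occupationMeasure_le_of_sum_le _ fun k => by
      rw [hsum k]; exact Measure.le_add_right le_rfl
  have hchar : IsCharacteristic G η Δ (τ 0) := isCharacteristic_of_tendsto hA hτ0 fun n =>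
    isCharacteristic_occupationMeasure hA _
  have heq := hchar.eq_of_le hA κ0.toStrategy hle
  -- Since `τ 0` is the occupation measure of `κ0`, cancelling the finite partial sums shows that no
  -- mass has escaped.
  have htail : ∀ k, τ k = tailMeasure η Δ κ0.toStrategy k := fun k => by
    have h1 := hsum k
    rw [heq, occupationMeasure_eq_sum_add_tail η Δ κ0.toStrategy k, add_comm, add_comm _ (τ k)] at h1
    exact (add_right_cancel_measure h1).symm
  -- the tails of the limit do not vanish
  have hεt : ε ≠ ∞ := ((hκ 0).trans_le le_top).ne
  have hlow : ∀ k, ε ≤ tailMeasure η Δ κ0.toStrategy k Set.univ := fun k => by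
    have h1 := hτ k _ (isBoundedCaratheodory_fst (S := fun _ => (1 : ℝ)) measurable_const
      (C := 1) (fun _ => by simp) (∀ j, A j))
    simp only [integral_const, smul_eq_mul, mul_one] at h1
    have h2 : ε.toReal ≤ (τ k).real Set.univ := by
      -- For `n ≥ k` the tail of `κ n` after `k` dominates its tail after `n`, whose mass exceeds
      -- `ε`.
      refine ge_of_tendsto h1 (hU ?_)
      filter_upwards [eventually_ge_atTop k] with n hn
      refine ENNReal.toReal_mono (measure_ne_top _ _) ?_
      exact (hκ n).le.trans (antitone_tailMeasure η Δ (κ n).toStrategy hn Set.univ)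
    rw [← htail k]
    exact (ENNReal.toReal_le_toReal hεt (measure_ne_top _ _)).1 h2
  exact hε.not_ge (ge_of_tendsto' (tendsto_tailMeasure_univ hΔ hA.absorbing κ0.toStrategy) hlow)

end Equivalence

end MarkovGame


theorem proposition4p8 {X : Type*} [MeasurableSpace X] {N : ℕ} (hN : 1 ≤ N) {A : Fin N → Type*}
    [∀ i, MetricSpace (A i)] [∀ i, TopologicalSpace.SeparableSpace (A i)]
    [∀ i, MeasurableSpace (A i)] [∀ i, BorelSpace (A i)] {p : ℕ} (hp : 1 ≤ p)
    (G : MarkovGame.GameModel X A p) (η : Measure X) [IsProbabilityMeasure η]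
    (ρ : Fin N → Fin p → ℝ) (lam : Measure X) (Δ : Set X)
    (hA : MarkovGame.AssumptionA G η ρ lam Δ) :
    Convex ℝ≥0 (MarkovGame.occupationSet G η Δ) ∧
    (∀ i, Convex ℝ≥0 (MarkovGame.marginalOccupationSet G η Δ i)) ∧
    (MarkovGame.IsUniformlyAbsorbing G η Δ ↔
      MarkovGame.IsCompactMetrizable (MarkovGame.wsTopology X (∀ j, A j))
        (MarkovGame.occupationSet G η Δ)) ∧
    ∀ i, MarkovGame.IsUniformlyAbsorbing G η Δ ↔
      MarkovGame.IsCompactMetrizable (MarkovGame.wsTopology X (A i))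
        (MarkovGame.marginalOccupationSet G η Δ i) := by
  have hcompact := hA.compactSpace
  have hsecond : ∀ i, SecondCountableTopology (A i) := fun i =>
    UniformSpace.secondCountable_of_separable (A i)
  have hne : Nonempty (∀ j, A j) := by
    obtain ⟨x⟩ := nonempty_of_isProbabilityMeasure η
    exact ⟨fun j => (G.actions_nonempty j x).some⟩
  -- (b) implies (a) goes through (c) for the first player, who exists because `1 ≤ N`.
  refine ⟨MarkovGame.convex_occupationSet hA, MarkovGame.convex_marginalOccupationSet hA,
    ⟨fun h => h.isCompactMetrizable hA, fun h => (h.marginal hA ⟨0, hN⟩).isUniformlyAbsorbing hA _⟩,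
    fun i => ⟨fun h => (h.isCompactMetrizable hA).marginal hA i,
      fun h => h.isUniformlyAbsorbing hA i⟩⟩
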